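/- Let $d\ge 0$ be an integer. For every $n\ge 1$ let $R_n>0$ be the radius for which the uniform probability measure $\mu_n$ on the Euclidean ball $\{x\in\mathbb{R}^n:\|x\|_2\le R_n\}$ is isotropic (centered, with covariance matrix the identity). For multi-indices $I,J\in\mathbb{N}^n$ with $|I|=|J|=d$ put $$C_{I,J}=\mathbb{E}_{\mu_n}[x^{I+J}]-\mathbb{E}_{\mu_n}[x^I]\,\mathbb{E}_{\mu_n}[x^J],\qquad \widetilde C_{I,J}=\frac{C_{I,J}}{I!},\qquad I!=I_1!\cdots I_n!,$$ so that $C=\mathrm{Cov}(X^{\otimes d})$ for $X\sim\mu_n$, in the monomial basis. Identify a vector $(a_I)_{|I|=d}$ with the homogeneous polynomial $\sum_{|I|=d} a_I x^I$, and write $\lambda_1(M)\le\lambda_2(M)\le\dots$ for the eigenvalues of $M$ in increasing order, with multiplicity. Then: 1. For every $n\ge1$, each of $C$ and $\widetilde C$ has $N=\binom{d+n-1}{d}$ real eigenvalues counted with multiplicity, and for all $1\le i\le N$ $$\lambda_i(\widetilde C)\le\lambda_i(C)\le d!\,\lambda_i(\widetilde C).$$ The eigenvalues of $\widetilde C$,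 with multiplicity, are $\eta_i$, $0\le i\le\lfloor d/2\rfloor$, where $\eta_i$ is taken $\binom{n+d-2i-1}{d-2i}-\binom{n+d-2i-3}{d-2i-2}$ times (the second binomial coefficient being read as $0$ if $d-2i<2$). Here $$\eta_i=R_n^{2d}\,\frac{n}{n+2d}\cdot\frac{1}{2^i\,i!\,n(n+2)\cdots(n+2d-2i-2)}\quad\text{for } i<\tfrac d2,$$ and, if $d$ is even, $$\eta_{d/2}=R_n^{2d}\,\frac{d^2}{2^{d/2}\,(d/2)!\,(n+2d)(n+d)\prod_{j=0}^{d/2-1}(d+n-2j)}.$$ 2. Let $d=2$. If $n\ge3$, then $\lambda_1(C)=\frac{4}{n+4}$, the $\lambda_1(C)$-eigenspace is the line spanned by $\sum_{i=1}^n x_i^2$, and $\lambda_i(C)\ge\frac57$ for all $2\le i\le N$. In particular $\lambda_1(C)=O(n^{-1})$ as $n\to\infty$. 3. Let $d\ge3$. For all $n\ge1$ and $1\le i\le N$ one has $\lambda_i(C)\ge\frac1{(d+1)!}$. If $n\ge d$, the $\lambda_1(C)$-eigenspace is the span of the monomials $x_{i_1}\cdots x_{i_d}$ with $i_1<\dots<i_d$.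 Moreover $\lim_{n\to\infty}\lambda_1(C)=\lim_{n\to\infty}\lambda_1(\widetilde C)=1$. -/

import Mathlib

open MeasureTheory Filter Topology Asymptotics
open scoped Nat

noncomputable section

/-- The multi-indices `I ∈ ℕⁿ` with `|I| = d`. -/
abbrev MultiIndex (n d : ℕ) : Type :=
  {I : Fin n →₀ ℕ // I ∈ (Finset.univ : Finset (Fin n)).finsuppAntidiag d}

/-- The monomial `x ^ I = ∏ j, x_j ^ I_j`. -/
def monomialAt {n : ℕ} (I : Fin n →₀ ℕ) (x : EuclideanSpace ℝ (Fin n)) : ℝ :=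
  ∏ j, x j ^ I j

/-- The uniform probability measure on the closed Euclidean ball of radius `r` about the origin
in `ℝⁿ` (for `r > 0`). -/
def uniformBall (n : ℕ) (r : ℝ) : Measure (EuclideanSpace ℝ (Fin n)) :=
  ProbabilityTheory.cond volume (Metric.closedBall 0 r)

/-- A measure on `ℝⁿ` is isotropic if it is centered and its covariance matrix is the identity. -/
def IsIsotropic {n : ℕ} (μ : Measure (EuclideanSpace ℝ (Fin n))) : Prop :=
  (∀ i, ∫ x, x i ∂μ = 0) ∧
    ∀ i j, ProbabilityTheory.covariance (fun x => x i) (fun x => x j) μ = if i = j then 1 else 0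

/-- `r` is the radius of the isotropic Euclidean ball in `ℝⁿ`. -/
def IsIsotropicRadius (n : ℕ) (r : ℝ) : Prop :=
  0 < r ∧ IsIsotropic (uniformBall n r)

/-- The covariance matrix `C = Cov(X^{⊗d})` for `X ∼ μ`, in the monomial basis:
`C_{I,J} = E[x^{I+J}] - E[x^I] E[x^J]`, `|I| = |J| = d`. -/
def tensorCov {n : ℕ} (d : ℕ) (μ : Measure (EuclideanSpace ℝ (Fin n))) :
    Matrix (MultiIndex n d) (MultiIndex n d) ℝ :=
  Matrix.of fun I J =>
    ∫ x, monomialAt (I.1 + J.1) x ∂μ - (∫ x, monomialAt I.1 x ∂μ) * ∫ x, monomialAt J.1 x ∂μ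

/-- The matrix `C̃` with `C̃_{I,J} = C_{I,J} / I!`, where `I! = ∏ j, I_j!`. -/
def tensorCovTilde {n : ℕ} (d : ℕ) (μ : Measure (EuclideanSpace ℝ (Fin n))) :
    Matrix (MultiIndex n d) (MultiIndex n d) ℝ :=
  Matrix.of fun I J => tensorCov d μ I J / ∏ j, ((I.1 j)! : ℝ)

/-- The real eigenvalues of a matrix, with algebraic multiplicity, in increasing order. -/
def sortedEigenvalues {ι : Type*} [Fintype ι] [DecidableEq ι] (M : Matrix ι ι ℝ) : List ℝ :=
  M.charpoly.roots.sort (· ≤ ·)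

/-- The `i`-th smallest eigenvalue `λ_i(M)`, counted from `i = 1`
(meaningful for `1 ≤ i ≤ (sortedEigenvalues M).length`). -/
def eigenvalueAt {ι : Type*} [Fintype ι] [DecidableEq ι] (M : Matrix ι ι ℝ) (i : ℕ) : ℝ :=
  (sortedEigenvalues M).getD (i - 1) 0

/-- The vector of the coefficients of `x^I`, `|I| = d`, of a polynomial. On homogeneous
polynomials of degree `d` this is the identification of `P_d(ℝⁿ)` with the space on which
`C` and `C̃` act. -/
def coeffVec {n : ℕ} (d : ℕ) (f : MvPolynomial (Fin n) ℝ) : MultiIndex n d → ℝ :=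
  fun I => f.coeff I.1

/-- The eigenvalue `η_i` of `C̃`, `0 ≤ i ≤ d / 2`, for the ball of radius `r` in `ℝⁿ`. -/
def etaValue (n d : ℕ) (r : ℝ) (i : ℕ) : ℝ :=
  if 2 * i < d then
    r ^ (2 * d) * (n / (n + 2 * d)) *
      (1 / (2 ^ i * (i ! : ℝ) * ∏ j ∈ Finset.range (d - i), ((n : ℝ) + 2 * j)))
  else
    r ^ (2 * d) * ((d : ℝ) ^ 2 /
      (2 ^ (d / 2) * ((d / 2)! : ℝ) * (n + 2 * d) * (n + d) *
        ∏ j ∈ Finset.range (d / 2), ((d : ℝ) + n - 2 * j)))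

/-- The dimension of the space of harmonic homogeneous polynomials of degree `k` on `ℝⁿ`,
`n ≥ 1`, i.e. `binom(n+k-1, n-1) - binom(n+k-3, n-1)`, the second binomial being absent
for `k < 2`. -/
def harmonicDim (n k : ℕ) : ℕ :=
  (n + k - 1).choose k - if 2 ≤ k then (n + k - 3).choose (k - 2) else 0

end

/-! In polar coordinates, a moment of degree `2d` of the ball is the standard Gaussian moment times
a factor depending only on the degree, `κ_d = R^(2d) / ((n+2)(n+4)⋯(n+2d))` (`ballMomentRatio`); odd
moments vanish. Isotropy means `R² = n + 2`. The operator `exp(Δ/2)` turns the Gaussian pairing of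
polynomials into the Fischer pairing, for which multiplication by `|x|²` and `Δ` are adjoint and
distinct degrees are orthogonal. Hence (`gaussMixedMoment_add`) the Gaussian matrix, with row `I`
divided by `I!`, represents `∑ (2^k k!)⁻² |x|^(2k) Δ^k`. The product of means is a multiple of the
single term `k = d/2`, so `C̃` represents an operator `L = ∑ c_k |x|^(2k) Δ^k` on forms of degree
`d`.

The spectrum of `L` follows from `AB` versus `BA`, without decomposing into harmonics. Write `L -
c_0 = |x|² T`. Up to a power of the variable, `|x|² T` and `T |x|²` have the same characteristic
polynomial, and `c_0 + T |x|²` is an operator of the same kind in degree `d - 2`. Each descent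
releases one eigenvalue, with multiplicity the difference of two dimensions (`charpoly_radialOp`);
`iterCoeff` solves the recursion for the coefficients.

With `D = diag(I!)`, the matrix `D^(-1/2) C D^(-1/2)` is similar to `C̃` and congruent to `C`. Since
`1 ≤ I! ≤ d!`, min-max gives the comparison of eigenvalues.

For `d ≥ 3` every `η_i` is at least `κ_d`, so `xᵀ C x ≥ κ_d ∑ I! x_I² ≥ κ_d |x|²`. Equality forces
`x` to live on squarefree monomials, and these are eigenvectors with eigenvalue `κ_d`. The bound and
the limit are then statements about `κ_d`. For `d = 2`, `C` is `κ_2 D` minus the rank-one matrix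
`2/(n+4) m mᵀ`, with `m` the coefficient vector of `∑ x_i²`. This lowers the eigenvalue on `m` to
`4/(n+4)` and leaves the quadratic form on `m⊥` at least `5/7`. -/

namespace TensorCov

/-! ### Commutation relations between `Δ`, the coordinates and `|x|²`. -/

open MvPolynomial

theorem pderiv_comm {σ : Type*} (i j : σ) (f : MvPolynomial σ ℝ) :
    pderiv i (pderiv j f) = pderiv j (pderiv i f) := by
  classical
  ext m
  rcases eq_or_ne i j with rfl | hij
  · rfl
  simp only [coeff_pderiv, Finsupp.add_apply, Finsupp.single_apply, if_neg hij, if_neg hij.symm]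
  rw [add_right_comm]
  push_cast
  ring

theorem isHomogeneous_pderiv {σ : Type*} {f : MvPolynomial σ ℝ} {d : ℕ}
    (hf : f.IsHomogeneous (d + 1)) (i : σ) : (pderiv i f).IsHomogeneous d := by
  simpa using hf.pderiv (i := i)

theorem pderiv_eq_zero_of_isHomogeneous_zero {σ : Type*} {f : MvPolynomial σ ℝ}
    (hf : f.IsHomogeneous 0) (i : σ) : pderiv i f = 0 := by
  rw [totalDegree_eq_zero_iff_eq_C.mp ((totalDegree_zero_iff_isHomogeneous σ).mpr hf), pderiv_C]

/-- The Laplacian on polynomials in `n` variables. -/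
noncomputable def lap (n : ℕ) : Module.End ℝ (MvPolynomial (Fin n) ℝ) :=
  ∑ i, (pderiv i).toLinearMap ∘ₗ (pderiv i).toLinearMap

/-- The polynomial `∑ X_i ^ 2`. -/
noncomputable def rsq (n : ℕ) : MvPolynomial (Fin n) ℝ := ∑ i, X i ^ 2

theorem lap_apply {n : ℕ} (f : MvPolynomial (Fin n) ℝ) :
    lap n f = ∑ i, pderiv i (pderiv i f) := by
  simp [lap]

theorem pderiv_rsq {n : ℕ} (i : Fin n) : pderiv i (rsq n) = 2 * X i := by
  simp only [rsq, map_sum, pderiv_pow, pderiv_X]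
  rw [Finset.sum_eq_single i]
  · simp
  · intro j _ hj
    simp [hj]
  · simp

theorem isHomogeneous_rsq (n : ℕ) : (rsq n).IsHomogeneous 2 :=
  IsHomogeneous.sum _ _ _ fun i _ => isHomogeneous_X_pow i 2

theorem isHomogeneous_lap {n d : ℕ} {f : MvPolynomial (Fin n) ℝ}
    (hf : f.IsHomogeneous (d + 2)) : (lap n f).IsHomogeneous d := by
  rw [lap_apply]
  exact IsHomogeneous.sum _ _ _ fun i _ => isHomogeneous_pderiv (isHomogeneous_pderiv hf i) i

theorem lap_eq_zero {n d : ℕ} {f : MvPolynomial (Fin n) ℝ} (hf : f.IsHomogeneous d)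
    (hd : d < 2) : lap n f = 0 := by
  rw [lap_apply]
  refine Finset.sum_eq_zero fun i _ => ?_
  interval_cases d
  · rw [pderiv_eq_zero_of_isHomogeneous_zero hf, map_zero]
  · exact pderiv_eq_zero_of_isHomogeneous_zero (isHomogeneous_pderiv hf i) i

theorem lap_pow_succ_apply {n : ℕ} (k : ℕ) (f : MvPolynomial (Fin n) ℝ) :
    (lap n ^ (k + 1)) f = (lap n ^ k) (lap n f) := by
  rw [pow_succ, Module.End.mul_apply]

theorem lap_pow_succ_apply' {n : ℕ} (k : ℕ) (f : MvPolynomial (Fin n) ℝ) :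
    (lap n ^ (k + 1)) f = lap n ((lap n ^ k) f) := by
  rw [pow_succ', Module.End.mul_apply]

theorem isHomogeneous_lap_pow {n : ℕ} (k : ℕ) {d : ℕ} {f : MvPolynomial (Fin n) ℝ}
    (hf : f.IsHomogeneous (d + 2 * k)) : ((lap n ^ k) f).IsHomogeneous d := by
  induction k generalizing f with
  | zero => simpa using hf
  | succ k ih =>
    rw [lap_pow_succ_apply]
    exact ih (isHomogeneous_lap (by convert hf using 1; ring))

theorem lap_pow_eq_zero {n : ℕ} (k : ℕ) {d : ℕ} {f : MvPolynomial (Fin n) ℝ}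
    (hf : f.IsHomogeneous d) (hd : d < 2 * k) : (lap n ^ k) f = 0 := by
  induction k generalizing f d with
  | zero => omega
  | succ k ih =>
    rw [lap_pow_succ_apply]
    rcases lt_or_ge d 2 with h | h
    · rw [lap_eq_zero hf h, map_zero]
    · obtain ⟨e, rfl⟩ := Nat.exists_eq_add_of_le' h
      exact ih (isHomogeneous_lap hf) (by omega)

theorem pderiv_lap {n : ℕ} (i : Fin n) (f : MvPolynomial (Fin n) ℝ) :
    pderiv i (lap n f) = lap n (pderiv i f) := by
  simp only [lap_apply, map_sum]
  refine Finset.sum_congr rfl fun j _ => ?_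
  rw [pderiv_comm i j, pderiv_comm i j]

theorem pderiv_lap_pow {n : ℕ} (i : Fin n) (k : ℕ) (f : MvPolynomial (Fin n) ℝ) :
    pderiv i ((lap n ^ k) f) = (lap n ^ k) (pderiv i f) := by
  induction k generalizing f with
  | zero => simp
  | succ k ih => rw [lap_pow_succ_apply, lap_pow_succ_apply, ih, pderiv_lap]

theorem lap_X_mul {n : ℕ} (i : Fin n) (f : MvPolynomial (Fin n) ℝ) :
    lap n (X i * f) = X i * lap n f + 2 * pderiv i f := by
  have h : ∀ j, pderiv j (pderiv j (X i * f))
      = X i * pderiv j (pderiv j f) + if j = i then 2 * pderiv i f else 0 := by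
    intro j
    rw [pderiv_mul, map_add, pderiv_mul, pderiv_mul, pderiv_X]
    split_ifs with hj
    · subst hj; simp; ring
    · simp [Ne.symm hj]
  simp_rw [lap_apply, h, Finset.sum_add_distrib, ← Finset.mul_sum]
  simp

/-- Iterates `[Δ, X_i] = 2 ∂_i`; since `Δ` commutes with `∂_i`, the commutators add up. This is what
makes `exp(Δ/2)` conjugate `X_i` into `X_i + ∂_i`. -/
theorem lap_pow_X_mul {n : ℕ} (i : Fin n) (k : ℕ) (f : MvPolynomial (Fin n) ℝ) :
    (lap n ^ (k + 1)) (X i * f)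
      = X i * (lap n ^ (k + 1)) f + (2 * (k + 1) : ℝ) • pderiv i ((lap n ^ k) f) := by
  induction k with
  | zero => simp [lap_X_mul, MvPolynomial.smul_eq_C_mul, ← map_ofNat C 2]
  | succ k ih =>
    rw [lap_pow_succ_apply', ih, map_add, lap_X_mul, map_smul, ← pderiv_lap,
      ← lap_pow_succ_apply', ← lap_pow_succ_apply', add_assoc]
    congr 1
    simp only [MvPolynomial.smul_eq_C_mul]
    push_cast
    simp only [map_add, map_mul, map_ofNat, map_one, map_natCast]
    ring

theorem lap_rsq_mul {n d : ℕ} {f : MvPolynomial (Fin n) ℝ} (hf : f.IsHomogeneous d) :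
    lap n (rsq n * f) = rsq n * lap n f + (2 * n + 4 * d : ℝ) • f := by
  have h : ∀ j, pderiv j (pderiv j (rsq n * f))
      = rsq n * pderiv j (pderiv j f) + (2 * f + 4 * (X j * pderiv j f)) := by
    intro j
    rw [pderiv_mul, map_add, pderiv_mul, pderiv_mul, pderiv_rsq, pderiv_mul, pderiv_X_self]
    have : pderiv j (2 : MvPolynomial (Fin n) ℝ) = 0 := by
      rw [← map_ofNat C 2, pderiv_C]
    rw [this]
    ring
  simp_rw [lap_apply, h, Finset.sum_add_distrib, ← Finset.mul_sum, hf.sum_X_mul_pderiv]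
  simp only [Finset.sum_const, Finset.card_univ, Fintype.card_fin, nsmul_eq_mul,
    MvPolynomial.smul_eq_C_mul]
  simp only [map_add, map_mul, map_ofNat, map_natCast]
  ring

/-- After `j` Laplacians the degree is `d - 2j`, so the commutators of `lap_rsq_mul` contribute `2n
+ 4(d - 2j)` for `j = 0, …, k`; the constant is their sum. -/
theorem lap_pow_rsq_mul {n d : ℕ} (k : ℕ) {f : MvPolynomial (Fin n) ℝ}
    (hf : f.IsHomogeneous d) :
    (lap n ^ (k + 1)) (rsq n * f) = rsq n * (lap n ^ (k + 1)) f
      + (2 * (k + 1) * (n + 2 * d - 2 * k) : ℝ) • (lap n ^ k) f := by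
  induction k with
  | zero =>
    simp only [zero_add, pow_one, pow_zero, Module.End.one_apply, lap_rsq_mul hf]
    congr 2
    push_cast
    ring
  | succ k ih =>
    rw [lap_pow_succ_apply', ih, map_add, map_smul, ← lap_pow_succ_apply']
    -- `lap_rsq_mul` needs the degree `d - 2(k+1)` to be a genuine natural number; below that
    -- `Δ^(k+1) f` is already zero.
    rcases lt_or_ge d (2 * (k + 1)) with h | h
    · simp [lap_pow_eq_zero (k + 1) hf h, lap_pow_succ_apply' (k + 1)]
    · obtain ⟨e, rfl⟩ := Nat.exists_eq_add_of_le' h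
      rw [lap_rsq_mul (isHomogeneous_lap_pow (k + 1) hf), ← lap_pow_succ_apply', add_assoc,
        ← add_smul]
      congr 2
      push_cast
      ring

end TensorCov

/-! ### Radial operators `∑ c_k |x|^(2k) Δ^k` and their characteristic polynomials. -/

namespace TensorCov

open MvPolynomial

theorem mem_multiIndex {n d : ℕ} {I : Fin n →₀ ℕ} :
    I ∈ (Finset.univ : Finset (Fin n)).finsuppAntidiag d ↔ I.degree = d := by
  simp [Finset.mem_finsuppAntidiag, Finsupp.degree_eq_sum]

theorem MultiIndex.degree_eq {n d : ℕ} (I : MultiIndex n d) : I.1.degree = d :=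
  mem_multiIndex.mp I.2

theorem card_multiIndex (n d : ℕ) : Fintype.card (MultiIndex n d) = (n + d - 1).choose d := by
  simpa using Finset.card_finsuppAntidiag_nat_eq_choose (s := (Finset.univ : Finset (Fin n))) d

theorem isHomogeneous_multiIndex {n d : ℕ} (I : MultiIndex n d) :
    (monomial I.1 (1 : ℝ)).IsHomogeneous d :=
  isHomogeneous_monomial _ (MultiIndex.degree_eq I)

theorem eq_sum_monomial {n d : ℕ} {f : MvPolynomial (Fin n) ℝ} (hf : f.IsHomogeneous d) :
    f = ∑ I : MultiIndex n d, coeff I.1 f • monomial I.1 (1 : ℝ) := by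
  classical
  ext m
  simp only [coeff_sum, coeff_smul, coeff_monomial, smul_eq_mul, mul_ite, mul_one, mul_zero]
  by_cases hm : m.degree = d
  · rw [Finset.sum_eq_single ⟨m, mem_multiIndex.mpr hm⟩]
    · simp
    · intro I _ hI
      rw [if_neg]
      rintro rfl
      exact hI rfl
    · simp
  · rw [hf.coeff_eq_zero hm, Finset.sum_eq_zero]
    intro I _
    rw [if_neg]
    rintro rfl
    exact hm (MultiIndex.degree_eq I)

/-- The matrix, in the monomial bases, of a linear operator seen as a map from polynomials of
degree `d` to polynomials of degree `e`. -/
noncomputable def coefMat {n : ℕ} (d e : ℕ) (F : Module.End ℝ (MvPolynomial (Fin n) ℝ)) :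
    Matrix (MultiIndex n e) (MultiIndex n d) ℝ :=
  Matrix.of fun I J => coeff I.1 (F (monomial J.1 1))

theorem coefMat_congr {n d e : ℕ} {F G : Module.End ℝ (MvPolynomial (Fin n) ℝ)}
    (h : ∀ f, f.IsHomogeneous d → F f = G f) : coefMat d e F = coefMat d e G := by
  ext I J
  simp [coefMat, h _ (isHomogeneous_multiIndex J)]

theorem coefMat_mul {n d e d' : ℕ} (F G : Module.End ℝ (MvPolynomial (Fin n) ℝ))
    (hF : ∀ f, f.IsHomogeneous d → (F f).IsHomogeneous e) :
    coefMat e d' G * coefMat d e F = coefMat d d' (G * F) := by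
  ext I J
  rw [Matrix.mul_apply]
  simp only [coefMat, Matrix.of_apply, Module.End.mul_apply]
  conv_rhs => rw [eq_sum_monomial (hF _ (isHomogeneous_multiIndex J))]
  simp [coeff_sum, mul_comm]

theorem coefMat_sub_smul_one {n d : ℕ} (F : Module.End ℝ (MvPolynomial (Fin n) ℝ)) (a : ℝ) :
    coefMat d d (F - a • 1) = coefMat d d F - Matrix.scalar _ a := by
  classical
  ext I J
  simp only [coefMat, Matrix.of_apply, LinearMap.sub_apply, LinearMap.smul_apply,
    Module.End.one_apply, coeff_sub, coeff_smul, coeff_monomial, Matrix.sub_apply,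
    Matrix.scalar_apply, Matrix.diagonal_apply, smul_eq_mul, mul_ite, mul_one, mul_zero]
  simp only [← Subtype.ext_iff, eq_comm (a := J)]

/-- The operator `∑_{k < N} c_k |x|^{2k} Δ^k`. -/
noncomputable def radialOp (n N : ℕ) (c : ℕ → ℝ) : Module.End ℝ (MvPolynomial (Fin n) ℝ) :=
  ∑ k ∈ Finset.range N, c k • (LinearMap.mulLeft ℝ (rsq n ^ k) * lap n ^ k)

theorem radialOp_apply {n N : ℕ} (c : ℕ → ℝ) (f : MvPolynomial (Fin n) ℝ) :
    radialOp n N c f = ∑ k ∈ Finset.range N, c k • (rsq n ^ k * (lap n ^ k) f) := by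
  simp [radialOp]

/-- The operator `∑_{k < N} c_{k+1} |x|^{2k} Δ^{k+1}`. -/
noncomputable def radialOpTail (n N : ℕ) (c : ℕ → ℝ) :
    Module.End ℝ (MvPolynomial (Fin n) ℝ) :=
  ∑ k ∈ Finset.range N, c (k + 1) • (LinearMap.mulLeft ℝ (rsq n ^ k) * lap n ^ (k + 1))

theorem radialOpTail_apply {n N : ℕ} (c : ℕ → ℝ) (f : MvPolynomial (Fin n) ℝ) :
    radialOpTail n N c f
      = ∑ k ∈ Finset.range N, c (k + 1) • (rsq n ^ k * (lap n ^ (k + 1)) f) := by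
  simp [radialOpTail]

theorem radialOp_succ {n N : ℕ} (c : ℕ → ℝ) (f : MvPolynomial (Fin n) ℝ) :
    radialOp n (N + 1) c f = c 0 • f + rsq n * radialOpTail n N c f := by
  rw [radialOp_apply, Finset.sum_range_succ', radialOpTail_apply, Finset.mul_sum, add_comm]
  simp only [pow_zero, one_mul, Module.End.one_apply]
  congr 1
  refine Finset.sum_congr rfl fun k _ => ?_
  rw [mul_smul_comm, pow_succ', mul_assoc]

theorem isHomogeneous_radialOpTail {n N d : ℕ} (c : ℕ → ℝ) {f : MvPolynomial (Fin n) ℝ}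
    (hf : f.IsHomogeneous (d + 2)) : (radialOpTail n N c f).IsHomogeneous d := by
  rw [radialOpTail_apply]
  refine IsHomogeneous.sum _ _ _ fun k _ => ?_
  rw [MvPolynomial.smul_eq_C_mul]
  refine IsHomogeneous.C_mul ?_ _
  rcases lt_or_ge d (2 * k) with h | h
  · rw [lap_pow_eq_zero (k + 1) hf (by omega), mul_zero]
    exact isHomogeneous_zero _ _ _
  · obtain ⟨e, rfl⟩ := Nat.exists_eq_add_of_le h
    exact ((isHomogeneous_rsq n).pow k).mul
      (isHomogeneous_lap_pow (d := e) (k + 1) (by convert hf using 1; ring))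

/-- Moving `|x|²` to the left past `Δ^(k+1)` costs one commutator, which lowers the index by one and
produces the correction in `c'`. The relation is needed only for `2k ≤ d`, because higher powers of
`Δ` kill degree `d`; `hN` removes the top term left over by the index shift. -/
theorem radialOpTail_rsq_mul {n N d : ℕ} (c c' : ℕ → ℝ)
    (hc : ∀ k, 2 * k ≤ d → c' k = c k + 2 * (k + 1) * (n + 2 * d - 2 * k) * c (k + 1)) (hN : d < 2 * N)
    {f : MvPolynomial (Fin n) ℝ} (hf : f.IsHomogeneous d) :
    c 0 • f + radialOpTail n N c (rsq n * f) = radialOp n N c' f := by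
  have h1 : ∀ k, c (k + 1) • (rsq n ^ k * (lap n ^ (k + 1)) (rsq n * f))
      = c (k + 1) • (rsq n ^ (k + 1) * (lap n ^ (k + 1)) f)
        + (2 * (k + 1) * (n + 2 * d - 2 * k) * c (k + 1)) • (rsq n ^ k * (lap n ^ k) f) := by
    intro k
    rw [lap_pow_rsq_mul k hf, mul_add, smul_add, mul_smul_comm, smul_smul,
      mul_comm (c (k + 1)), pow_succ (rsq n) k, mul_assoc (rsq n ^ k)]
  have h2 : c 0 • f + ∑ k ∈ Finset.range N, c (k + 1) • (rsq n ^ (k + 1) * (lap n ^ (k + 1)) f)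
      = ∑ k ∈ Finset.range N, c k • (rsq n ^ k * (lap n ^ k) f) := by
    have := Finset.sum_range_succ' (fun k => c k • (rsq n ^ k * (lap n ^ k) f)) N
    rw [Finset.sum_range_succ, lap_pow_eq_zero N hf hN, mul_zero, smul_zero, add_zero] at this
    rw [this, add_comm]
    simp
  rw [radialOpTail_apply, Finset.sum_congr rfl fun k _ => h1 k, Finset.sum_add_distrib,
    ← add_assoc, h2, radialOp_apply, ← Finset.sum_add_distrib]
  refine Finset.sum_congr rfl fun k _ => ?_
  rcases le_or_gt (2 * k) d with hk | hk
  · rw [← add_smul, ← hc k hk]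
  · simp [lap_pow_eq_zero k hf hk]

theorem card_multiIndex_le {n : ℕ} (hn : 1 ≤ n) (d : ℕ) :
    Fintype.card (MultiIndex n d) ≤ Fintype.card (MultiIndex n (d + 2)) := by
  refine Fintype.card_le_of_injective (fun I => ⟨I.1 + Finsupp.single ⟨0, hn⟩ 2, ?_⟩) ?_
  · rw [mem_multiIndex, map_add, MultiIndex.degree_eq]; simp
  · intro I J h
    exact Subtype.ext (add_right_cancel (congrArg Subtype.val h))

theorem charpoly_eq_comp {ι : Type*} [Fintype ι] [DecidableEq ι] (M : Matrix ι ι ℝ) (a : ℝ) :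
    M.charpoly = (M - Matrix.scalar ι a).charpoly.comp (Polynomial.X - Polynomial.C a) := by
  rw [Matrix.charpoly_sub_scalar, Polynomial.comp_assoc]
  simp

/-- With `A` multiplication by `|x|²` and `B` the tail operator, the matrices shifted by `c 0` are
`AB` in degree `d + 2` and `BA` in degree `d`. Their characteristic polynomials differ by a power of
the variable, whose exponent is the difference of the sizes. -/
theorem charpoly_radialOp_succ {n N d : ℕ} (hn : 1 ≤ n) (c c' : ℕ → ℝ)
    (hc : ∀ k, 2 * k ≤ d → c' k = c k + 2 * (k + 1) * (n + 2 * d - 2 * k) * c (k + 1)) (hN : d < 2 * N) :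
    (coefMat (d + 2) (d + 2) (radialOp n (N + 1) c)).charpoly
      = (Polynomial.X - Polynomial.C (c 0))
          ^ (Fintype.card (MultiIndex n (d + 2)) - Fintype.card (MultiIndex n d))
        * (coefMat d d (radialOp n N c')).charpoly := by
  set A : Matrix (MultiIndex n (d + 2)) (MultiIndex n d) ℝ :=
    coefMat d (d + 2) (LinearMap.mulLeft ℝ (rsq n)) with hA
  set B : Matrix (MultiIndex n d) (MultiIndex n (d + 2)) ℝ :=
    coefMat (d + 2) d (radialOpTail n N c) with hB
  have h1 : coefMat (d + 2) (d + 2) (radialOp n (N + 1) c) - Matrix.scalar _ (c 0) = A * B := by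
    rw [hA, hB, coefMat_mul _ _ fun f hf => isHomogeneous_radialOpTail c hf,
      ← coefMat_sub_smul_one]
    refine coefMat_congr fun f _ => ?_
    simp [radialOp_succ]
  have h2 : coefMat d d (radialOp n N c') - Matrix.scalar _ (c 0) = B * A := by
    rw [hA, hB, coefMat_mul _ _ fun f hf => ?_, ← coefMat_sub_smul_one]
    · refine coefMat_congr fun f hf => ?_
      simp [← radialOpTail_rsq_mul c c' hc hN hf]
    · rw [LinearMap.mulLeft_apply, add_comm]
      exact (isHomogeneous_rsq n).mul hf
  rw [charpoly_eq_comp _ (c 0), h1, Matrix.charpoly_mul_comm_of_le _ _ (card_multiIndex_le hn d),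
    charpoly_eq_comp (coefMat d d (radialOp n N c')) (c 0), h2]
  simp

theorem charpoly_radialOp_of_lt_two {n N d : ℕ} (hd : d < 2) (c : ℕ → ℝ) :
    (coefMat d d (radialOp n (N + 1) c)).charpoly
      = (Polynomial.X - Polynomial.C (c 0)) ^ Fintype.card (MultiIndex n d) := by
  have h1 : coefMat d d (radialOp n (N + 1) c) - Matrix.scalar _ (c 0) = 0 := by
    rw [← coefMat_sub_smul_one]
    ext I J
    simp [coefMat, radialOp_succ, radialOpTail_apply, lap_pow_succ_apply,
      lap_eq_zero (isHomogeneous_multiIndex J) hd]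
  rw [charpoly_eq_comp _ (c 0), h1, Matrix.charpoly_zero]
  simp

theorem harmonicDim_add_two (n d : ℕ) :
    harmonicDim n (d + 2)
      = Fintype.card (MultiIndex n (d + 2)) - Fintype.card (MultiIndex n d) := by
  rw [card_multiIndex, card_multiIndex, harmonicDim, if_pos (by omega)]
  congr 2

theorem harmonicDim_of_lt_two {n d : ℕ} (hd : d < 2) :
    harmonicDim n d = Fintype.card (MultiIndex n d) := by
  rw [card_multiIndex, harmonicDim, if_neg (by omega), Nat.sub_zero]

/-- `s i` is the coefficient sequence after `i` descents, when the degree is `d - 2i`; each descent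
splits off the root `s i 0`. The condition `d < 2 * N` survives because `N` drops by one while `d`
drops by two. -/
theorem charpoly_radialOp {n : ℕ} (hn : 1 ≤ n) (d : ℕ) : ∀ (N : ℕ) (s : ℕ → ℕ → ℝ), d < 2 * N →
    (∀ i k, 2 * i + 2 + 2 * k ≤ d → s (i + 1) k = s i k
      + 2 * (k + 1) * (n + 2 * (d - 2 * i - 2) - 2 * k) * s i (k + 1)) →
    (coefMat d d (radialOp n N (s 0))).charpoly
      = ∏ i ∈ Finset.range (d / 2 + 1),
        (Polynomial.X - Polynomial.C (s i 0)) ^ harmonicDim n (d - 2 * i) := by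
  induction d using Nat.twoStepInduction with
  | zero =>
    intro N s hN _
    obtain ⟨N, rfl⟩ := Nat.exists_eq_succ_of_ne_zero (n := N) (by omega)
    rw [charpoly_radialOp_of_lt_two (by omega)]
    simp [harmonicDim_of_lt_two]
  | one =>
    intro N s hN _
    obtain ⟨N, rfl⟩ := Nat.exists_eq_succ_of_ne_zero (n := N) (by omega)
    rw [charpoly_radialOp_of_lt_two (by omega)]
    simp [harmonicDim_of_lt_two]
  | more d ih _ =>
    intro N s hN hs
    obtain ⟨N, rfl⟩ := Nat.exists_eq_succ_of_ne_zero (n := N) (by omega)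
    rw [charpoly_radialOp_succ hn (s 0) (s 1) (fun k hk => ?_) (by omega),
      ih N (fun i => s (i + 1)) (by omega) (fun i k hi => ?_),
      show (d + 2) / 2 + 1 = (d / 2 + 1) + 1 by omega, Finset.prod_range_succ' _ (d / 2 + 1),
      mul_comm, Nat.mul_zero, Nat.sub_zero, harmonicDim_add_two]
    · congr 1
      refine Finset.prod_congr rfl fun i _ => ?_
      congr 2
      omega
    · rw [hs (i + 1) k (by omega)]
      push_cast
      ring
    · rw [hs 0 k (by omega)]
      push_cast
      ring

end TensorCov

/-! ### Gaussian moments, the Fischer pairing and Wick's formula. -/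

namespace TensorCov

open MvPolynomial

/-- The moments of the standard Gaussian distribution on the line. -/
noncomputable def gaussMoment : ℕ → ℝ
  | 0 => 1
  | 1 => 0
  | k + 2 => (k + 1) * gaussMoment k

theorem gaussMoment_succ (k : ℕ) : gaussMoment (k + 1) = k * gaussMoment (k - 1) := by
  cases k with
  | zero => simp [gaussMoment]
  | succ k => simp [gaussMoment]

/-- The mixed moments of the standard Gaussian distribution on `ℝⁿ`. -/
noncomputable def gaussMixedMoment {n : ℕ} (K : Fin n →₀ ℕ) : ℝ := ∏ j, gaussMoment (K j)

/-- Gaussian integration by parts, `E[x_i f] = E[∂_i f]`, on monomials. When `K i = 0` the truncated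
subtraction is harmless, since the factor `K i` vanishes. -/
theorem gaussMixedMoment_add_single {n : ℕ} (K : Fin n →₀ ℕ) (i : Fin n) :
    gaussMixedMoment (K + Finsupp.single i 1)
      = K i * gaussMixedMoment (K - Finsupp.single i 1) := by
  classical
  have h : ∀ L : Fin n →₀ ℕ, (∀ j, j ≠ i → L j = K j) →
      gaussMixedMoment L = gaussMoment (L i) * ∏ j ∈ Finset.univ.erase i, gaussMoment (K j) := by
    intro L hL
    rw [gaussMixedMoment, ← Finset.mul_prod_erase _ _ (Finset.mem_univ i)]
    congr 1
    exact Finset.prod_congr rfl fun j hj => by rw [hL j (Finset.ne_of_mem_erase hj)]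
  rw [h _ fun j hj => by simp [hj.symm],
    h _ fun j hj => by simp [hj.symm]]
  simp only [Finsupp.add_apply, Finsupp.tsub_apply, Finsupp.single_eq_same, gaussMoment_succ]
  ring

/-- The product `∏ j, I_j!`. -/
noncomputable def multiFactorial {n : ℕ} (I : Fin n →₀ ℕ) : ℝ := ∏ j, ((I j)! : ℝ)

theorem multiFactorial_add_single {n : ℕ} (I : Fin n →₀ ℕ) (i : Fin n) :
    multiFactorial (I + Finsupp.single i 1) = (I i + 1) * multiFactorial I := by
  classical
  rw [multiFactorial, multiFactorial, ← Finset.mul_prod_erase _ _ (Finset.mem_univ i),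
    ← Finset.mul_prod_erase (a := i) _ _ (Finset.mem_univ i), ← mul_assoc]
  congr 1
  · simp [Nat.factorial_succ]
  · exact Finset.prod_congr rfl fun j hj => by
      simp [(Finset.ne_of_mem_erase hj).symm]

/-- The Fischer inner product `⟨f, g⟩ = ∑_I I! f_I g_I`. -/
noncomputable def fischer (n : ℕ) :
    MvPolynomial (Fin n) ℝ →ₗ[ℝ] MvPolynomial (Fin n) ℝ →ₗ[ℝ] ℝ :=
  (basisMonomials (Fin n) ℝ).constr ℝ fun I => multiFactorial I • lcoeff ℝ I

theorem fischer_monomial {n : ℕ} (I : Fin n →₀ ℕ) (f : MvPolynomial (Fin n) ℝ) :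
    fischer n (monomial I 1) f = multiFactorial I * coeff I f := by
  have := (basisMonomials (Fin n) ℝ).constr_basis ℝ
    (fun I => multiFactorial I • lcoeff ℝ I) I
  rw [coe_basisMonomials] at this
  rw [fischer, this]
  simp

theorem linearMap_ext_monomial {n : ℕ} {V : Type*} [AddCommMonoid V] [Module ℝ V]
    {F G : MvPolynomial (Fin n) ℝ →ₗ[ℝ] V} (h : ∀ I, F (monomial I 1) = G (monomial I 1)) :
    F = G :=
  (basisMonomials (Fin n) ℝ).ext fun I => by simpa using h I

theorem fischer_comm {n : ℕ} (f g : MvPolynomial (Fin n) ℝ) :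
    fischer n f g = fischer n g f := by
  classical
  have : fischer n = (fischer n).flip := by
    refine linearMap_ext_monomial fun I => linearMap_ext_monomial fun J => ?_
    rw [LinearMap.flip_apply, fischer_monomial, fischer_monomial, coeff_monomial, coeff_monomial]
    rcases eq_or_ne I J with rfl | h
    · rfl
    · simp [h, h.symm]
  exact congrArg (fun F => F f g) this

theorem fischer_X_mul {n : ℕ} (i : Fin n) (f g : MvPolynomial (Fin n) ℝ) :
    fischer n (X i * f) g = fischer n f (pderiv i g) := by
  have : (fischer n).comp (LinearMap.mulLeft ℝ (X i))
      = ((fischer n).flip.comp (pderiv i).toLinearMap).flip := by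
    refine linearMap_ext_monomial fun I => LinearMap.ext fun g => ?_
    have hX : X i * monomial I (1 : ℝ) = monomial (I + Finsupp.single i 1) 1 := by
      rw [X, monomial_mul, add_comm, mul_one]
    simp only [LinearMap.comp_apply, LinearMap.mulLeft_apply, LinearMap.flip_apply, hX,
      Derivation.coeFn_coe, fischer_monomial, coeff_pderiv, multiFactorial_add_single]
    ring
  exact congrArg (fun F => F f g) this

theorem fischer_rsq_mul {n : ℕ} (f g : MvPolynomial (Fin n) ℝ) :
    fischer n (rsq n * f) g = fischer n f (lap n g) := by
  rw [rsq, Finset.sum_mul, lap_apply]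
  simp only [map_sum, LinearMap.sum_apply, sq, mul_assoc, fischer_X_mul]

theorem fischer_lap_pow {n : ℕ} (k : ℕ) (f g : MvPolynomial (Fin n) ℝ) :
    fischer n ((lap n ^ k) f) g = fischer n f (rsq n ^ k * g) := by
  induction k generalizing g with
  | zero => simp
  | succ k ih =>
    rw [lap_pow_succ_apply', fischer_comm, ← fischer_rsq_mul, fischer_comm, ih, pow_succ,
      mul_assoc]

theorem fischer_eq_zero {n d e : ℕ} {f g : MvPolynomial (Fin n) ℝ} (hf : f.IsHomogeneous d)
    (hg : g.IsHomogeneous e) (h : d ≠ e) : fischer n f g = 0 := by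
  rw [eq_sum_monomial hf]
  simp only [map_sum, LinearMap.sum_apply, map_smul, LinearMap.smul_apply, fischer_monomial]
  refine Finset.sum_eq_zero fun I _ => ?_
  rw [hg.coeff_eq_zero (by rwa [MultiIndex.degree_eq]), mul_zero, smul_zero]

/-- The coefficient `1 / (2 ^ k k!)` of `Δ ^ k` in `exp (Δ / 2)`. -/
noncomputable def heatCoeff (k : ℕ) : ℝ := (2 ^ k * (k ! : ℝ))⁻¹

theorem heatCoeff_succ (k : ℕ) : heatCoeff (k + 1) * (2 * (k + 1)) = heatCoeff k := by
  rw [heatCoeff, heatCoeff, Nat.factorial_succ]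
  push_cast
  field_simp
  ring

/-- The operator `exp (Δ / 2)` on polynomials. -/
noncomputable def heat (n : ℕ) : Module.End ℝ (MvPolynomial (Fin n) ℝ) :=
  (basisMonomials (Fin n) ℝ).constr ℝ fun I =>
    ∑ k ∈ Finset.range (I.degree + 1), heatCoeff k • (lap n ^ k) (monomial I 1)

theorem heat_monomial {n : ℕ} (I : Fin n →₀ ℕ) {N : ℕ} (hN : I.degree < N) :
    heat n (monomial I 1) = ∑ k ∈ Finset.range N, heatCoeff k • (lap n ^ k) (monomial I 1) := by
  have := (basisMonomials (Fin n) ℝ).constr_basis ℝ (fun I =>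
    ∑ k ∈ Finset.range (I.degree + 1), heatCoeff k • (lap n ^ k) (monomial I (1 : ℝ))) I
  rw [coe_basisMonomials] at this
  rw [heat, this]
  refine Finset.sum_subset (Finset.range_mono hN) fun k _ hk => ?_
  rw [lap_pow_eq_zero k (isHomogeneous_monomial _ rfl) (by rw [Finset.mem_range] at hk; omega),
    smul_zero]

/-- Term by term: the commutator of `Δ^(k+1)` with `X_i` carries the factor `2(k+1)`, which turns
`heatCoeff (k + 1)` into `heatCoeff k`. -/
theorem heat_X_mul {n : ℕ} (i : Fin n) (f : MvPolynomial (Fin n) ℝ) :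
    heat n (X i * f) = X i * heat n f + pderiv i (heat n f) := by
  have : (heat n).comp (LinearMap.mulLeft ℝ (X i))
      = (LinearMap.mulLeft ℝ (X i)).comp (heat n) + (pderiv i).toLinearMap.comp (heat n) := by
    refine linearMap_ext_monomial fun I => ?_
    have hX : X i * monomial I (1 : ℝ) = monomial (I + Finsupp.single i 1) 1 := by
      rw [X, monomial_mul, add_comm, mul_one]
    simp only [LinearMap.add_apply, LinearMap.comp_apply, LinearMap.mulLeft_apply, hX,
      Derivation.coeFn_coe]
    rw [heat_monomial _ (N := I.degree + 2) (by simp), ← hX, Finset.sum_range_succ']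
    simp only [lap_pow_X_mul, smul_add, smul_smul, heatCoeff_succ]
    rw [Finset.sum_add_distrib]
    have h1 : pderiv i (heat n (monomial I 1)) = ∑ k ∈ Finset.range (I.degree + 1),
        heatCoeff k • pderiv i ((lap n ^ k) (monomial I (1 : ℝ))) := by
      rw [heat_monomial I (N := I.degree + 1) (by omega), map_sum]
      exact Finset.sum_congr rfl fun k _ => Derivation.map_smul _ _ _
    rw [h1, heat_monomial I (N := I.degree + 2) (by omega),
      Finset.sum_range_succ' _ (I.degree + 1), mul_add, Finset.mul_sum]
    simp only [mul_smul_comm, pow_zero, Module.End.one_apply]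
    abel
  exact congrArg (fun F => F f) this

theorem heat_pderiv {n : ℕ} (i : Fin n) (f : MvPolynomial (Fin n) ℝ) :
    heat n (pderiv i f) = pderiv i (heat n f) := by
  have : (heat n).comp (pderiv i).toLinearMap = (pderiv i).toLinearMap.comp (heat n) := by
    refine linearMap_ext_monomial fun I => ?_
    have hX : pderiv i (monomial I (1 : ℝ))
        = (I i : ℝ) • monomial (I - Finsupp.single i 1) 1 := by
      rw [pderiv_monomial, smul_monomial, smul_eq_mul, mul_one, one_mul]
    simp only [LinearMap.comp_apply, Derivation.coeFn_coe]
    have hdeg : (I - Finsupp.single i 1).degree < I.degree + 1 :=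
      Nat.lt_succ_of_le (Finsupp.degree_mono tsub_le_self)
    rw [hX, map_smul, heat_monomial _ hdeg, heat_monomial I (N := I.degree + 1) (by omega),
      map_sum, Finset.smul_sum]
    refine Finset.sum_congr rfl fun k _ => ?_
    rw [Derivation.map_smul, pderiv_lap_pow, hX, map_smul, smul_comm]
  exact congrArg (fun F => F f) this

theorem heat_one (n : ℕ) : heat n 1 = 1 := by
  have := heat_monomial (n := n) 0 (N := 1) (by simp)
  simpa [heatCoeff] using this

/-- `exp(Δ/2)` intertwines multiplication by `X_i` with `X_i + ∂_i`, which is self-adjoint for the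
Fischer pairing. So a factor `X_i` can be carried from `h` to `f` one variable at a time. -/
theorem fischer_heat {n : ℕ} (h f : MvPolynomial (Fin n) ℝ) :
    fischer n (heat n h) (heat n f) = fischer n 1 (heat n (h * f)) := by
  induction h using MvPolynomial.induction_on generalizing f with
  | C a =>
    have : (C a : MvPolynomial (Fin n) ℝ) = a • 1 := by rw [MvPolynomial.smul_eq_C_mul, mul_one]
    rw [this, map_smul, heat_one, smul_mul_assoc, one_mul, map_smul, map_smul, map_smul]
    rfl
  | add p q hp hq => rw [map_add, map_add, LinearMap.add_apply, hp, hq, add_mul, map_add, map_add]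
  | mul_X p i hp =>
    rw [mul_comm p, heat_X_mul, map_add, LinearMap.add_apply, fischer_X_mul i (heat n p),
      fischer_comm (pderiv i _), ← fischer_X_mul i (heat n f), fischer_comm (X i * _), ← map_add,
      add_comm, ← heat_X_mul, hp]
    congr 2
    ring

/-- Pairing with `1` kills the part `X_i * _` of `heat_X_mul`, leaving the integration by parts
recursion of the Gaussian moments. -/
theorem fischer_one_heat_monomial {n : ℕ} (K : Fin n →₀ ℕ) :
    fischer n 1 (heat n (monomial K 1)) = gaussMixedMoment K := by
  induction hd : K.degree using Nat.strong_induction_on generalizing K with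
  | _ d ih =>
    subst hd
    rcases eq_or_ne K 0 with rfl | hK
    · have : (monomial (0 : Fin n →₀ ℕ)) (1 : ℝ) = 1 := rfl
      rw [this, heat_one, ← this, fischer_monomial]
      simp [multiFactorial, gaussMixedMoment, gaussMoment]
    · obtain ⟨i, hi⟩ := Finsupp.ne_iff.mp hK
      obtain ⟨L, rfl⟩ : ∃ L, K = L + Finsupp.single i 1 := by
        refine ⟨K - Finsupp.single i 1, (tsub_add_cancel_of_le ?_).symm⟩
        rw [Finsupp.single_le_iff]
        exact Nat.one_le_iff_ne_zero.mpr hi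
      have hX : monomial (L + Finsupp.single i 1) (1 : ℝ) = X i * monomial L 1 := by
        rw [X, monomial_mul, add_comm, mul_one]
      have h1 : pderiv i (1 : MvPolynomial (Fin n) ℝ) = 0 := pderiv_one
      have hdeg : (L - Finsupp.single i 1).degree < (L + Finsupp.single i 1).degree := by
        refine lt_of_le_of_lt (Finsupp.degree_mono tsub_le_self) ?_
        simp
      rw [hX, heat_X_mul, map_add, fischer_comm, fischer_X_mul, h1, map_zero, zero_add,
        ← heat_pderiv, pderiv_monomial, gaussMixedMoment_add_single, ← ih _ hdeg _ rfl,
        one_mul]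
      have : monomial (L - Finsupp.single i 1) (L i : ℝ)
          = (L i : ℝ) • monomial (L - Finsupp.single i 1) 1 := by
        rw [smul_monomial, smul_eq_mul, mul_one]
      rw [this, map_smul, map_smul, smul_eq_mul]

/-- Wick's formula: mixed Gaussian moments in terms of the operators `|x|^{2k} Δ^k`. -/
theorem gaussMixedMoment_add {n d N : ℕ} (hN : d < N) (I J : MultiIndex n d) :
    gaussMixedMoment (I.1 + J.1) = multiFactorial I.1 *
      coeff I.1 (radialOp n N (fun k => heatCoeff k ^ 2) (monomial J.1 1)) := by
  have hm : monomial (I.1 + J.1) (1 : ℝ) = monomial I.1 1 * monomial J.1 1 := by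
    rw [monomial_mul, mul_one]
  rw [← fischer_one_heat_monomial, hm, ← fischer_heat,
    heat_monomial I.1 (N := N) (by rwa [MultiIndex.degree_eq]),
    heat_monomial J.1 (N := N) (by rwa [MultiIndex.degree_eq]), ← fischer_monomial,
    radialOp_apply]
  simp only [map_sum, LinearMap.sum_apply, map_smul, LinearMap.smul_apply]
  refine Finset.sum_congr rfl fun k _ => ?_
  rw [Finset.sum_eq_single_of_mem k ‹_›]
  · rw [fischer_lap_pow, sq, smul_smul]
  · intro l _ hl
    -- Terms beyond half the degree vanish. Discarding them first makes `d - 2 * k` and `d - 2 * l`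
    -- true differences, so `k ≠ l` gives distinct degrees and orthogonality.
    rcases lt_or_ge d (2 * k) with hk | hk
    · simp [lap_pow_eq_zero k (isHomogeneous_multiIndex J) hk]
    rcases lt_or_ge d (2 * l) with hl' | hl'
    · simp [lap_pow_eq_zero l (isHomogeneous_multiIndex I) hl']
    rw [fischer_eq_zero (d := d - 2 * l) (e := d - 2 * k) (isHomogeneous_lap_pow l ?_)
      (isHomogeneous_lap_pow k ?_) (by omega), smul_zero]
    · rw [Nat.sub_add_cancel hl']; exact isHomogeneous_multiIndex I
    · rw [Nat.sub_add_cancel hk]; exact isHomogeneous_multiIndex J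

theorem lap_pow_monomial_eq_C {n m : ℕ} (I : MultiIndex n (2 * m)) :
    heatCoeff m • (lap n ^ m) (monomial I.1 1) = gaussMixedMoment I.1 • 1 := by
  have h0 : ((lap n ^ m) (monomial I.1 (1 : ℝ))).IsHomogeneous 0 :=
    isHomogeneous_lap_pow m (by rw [zero_add]; exact isHomogeneous_multiIndex I)
  have hC := totalDegree_eq_zero_iff_eq_C.mp ((totalDegree_zero_iff_isHomogeneous _).mpr h0)
  have h : gaussMixedMoment I.1 = heatCoeff m * coeff 0 ((lap n ^ m) (monomial I.1 (1 : ℝ))) := by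
    have h1 : (1 : MvPolynomial (Fin n) ℝ) = monomial 0 1 := rfl
    rw [← fischer_one_heat_monomial,
      heat_monomial I.1 (N := 2 * m + 1) (by rw [MultiIndex.degree_eq]; omega), h1,
      fischer_monomial, coeff_sum, Finset.sum_eq_single_of_mem m (by simp; omega)]
    · simp [multiFactorial]
    · intro k _ hk
      rw [coeff_smul]
      rcases lt_or_ge m k with hk' | hk'
      · rw [lap_pow_eq_zero k (isHomogeneous_multiIndex I) (by omega)]; simp
      · have : ((lap n ^ k) (monomial I.1 (1 : ℝ))).IsHomogeneous (2 * m - 2 * k) :=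
          isHomogeneous_lap_pow k (by
            rw [Nat.sub_add_cancel (by omega)]; exact isHomogeneous_multiIndex I)
        rw [this.coeff_eq_zero (by simp; omega), smul_zero]
  rw [hC, h, MvPolynomial.smul_eq_C_mul, MvPolynomial.smul_eq_C_mul, mul_one, ← C_mul]

/-- `Δ^m` sends a form of degree `2m` to a constant proportional to its Gaussian mean. The product
of two means is thus a Fischer pairing of constants, and adjointness makes it a single term
`|x|^(2m) Δ^m`, so subtracting the means keeps the operator radial. -/
theorem gaussMixedMoment_mul {n m : ℕ} (I J : MultiIndex n (2 * m)) :
    gaussMixedMoment I.1 * gaussMixedMoment J.1 = multiFactorial I.1 *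
      coeff I.1 (heatCoeff m ^ 2 • (rsq n ^ m * (lap n ^ m) (monomial J.1 1))) := by
  have h1 : fischer n 1 1 = 1 := by
    have h1 : (1 : MvPolynomial (Fin n) ℝ) = monomial 0 1 := rfl
    rw [h1, fischer_monomial]
    simp [multiFactorial]
  have h2 : fischer n (heatCoeff m • (lap n ^ m) (monomial I.1 1))
      (heatCoeff m • (lap n ^ m) (monomial J.1 1))
      = gaussMixedMoment I.1 * gaussMixedMoment J.1 := by
    rw [lap_pow_monomial_eq_C, lap_pow_monomial_eq_C]
    simp [h1, mul_comm]
  rw [← h2, ← fischer_monomial]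
  simp only [map_smul, LinearMap.smul_apply, fischer_lap_pow, smul_smul, sq]

theorem gaussMoment_of_odd {k : ℕ} (hk : Odd k) : gaussMoment k = 0 := by
  obtain ⟨m, rfl⟩ := hk
  induction m with
  | zero => simp [gaussMoment]
  | succ m ih =>
    rw [show 2 * (m + 1) + 1 = (2 * m + 1) + 2 by ring, gaussMoment, ih, mul_zero]

theorem gaussMixedMoment_eq_zero {n : ℕ} {K : Fin n →₀ ℕ} {i : Fin n} (h : Odd (K i)) :
    gaussMixedMoment K = 0 :=
  Finset.prod_eq_zero (Finset.mem_univ i) (gaussMoment_of_odd h)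

theorem gaussMixedMoment_of_odd_degree {n : ℕ} {K : Fin n →₀ ℕ} (h : Odd K.degree) :
    gaussMixedMoment K = 0 := by
  by_contra h0
  refine Nat.not_even_iff_odd.mpr h ?_
  rw [Finsupp.degree_eq_sum]
  refine Finset.even_sum _ fun i _ => ?_
  by_contra hi
  exact h0 (gaussMixedMoment_eq_zero (Nat.not_even_iff_odd.mp hi))

end TensorCov

/-! ### Moments of the uniform measure on the ball. -/

namespace TensorCov

/-- The moments of the Gaussian weight on the half line. -/
noncomputable def halfMoment (s : ℕ) : ℝ :=
  ∫ r in Set.Ioi (0 : ℝ), r ^ s * Real.exp (-(r ^ 2) / 2)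

theorem halfMoment_eq (s : ℕ) : halfMoment s
    = (1 / 2 : ℝ) ^ (-((s : ℝ) + 1) / 2) * (1 / 2) * Real.Gamma (((s : ℝ) + 1) / 2) := by
  rw [← integral_rpow_mul_exp_neg_mul_rpow (p := 2) (q := s) (b := 1 / 2) (by norm_num)
    (by have := Nat.cast_nonneg (α := ℝ) s; linarith) (by norm_num), halfMoment]
  refine setIntegral_congr_fun measurableSet_Ioi fun r _ => ?_
  simp only [Real.rpow_natCast, Real.rpow_two]
  congr 2
  ring

theorem halfMoment_pos (s : ℕ) : 0 < halfMoment s := by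
  rw [halfMoment_eq]
  have := Real.Gamma_pos_of_pos (s := ((s : ℝ) + 1) / 2) (by positivity)
  positivity

theorem halfMoment_add_two (s : ℕ) : halfMoment (s + 2) = (s + 1) * halfMoment s := by
  rw [halfMoment_eq, halfMoment_eq]
  have h1 : -(((s + 2 : ℕ) : ℝ) + 1) / 2 = -((s : ℝ) + 1) / 2 - 1 := by push_cast; ring
  have h2 : (((s + 2 : ℕ) : ℝ) + 1) / 2 = ((s : ℝ) + 1) / 2 + 1 := by push_cast; ring
  rw [h1, h2, Real.rpow_sub_one (by norm_num), Real.Gamma_add_one (by positivity)]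
  ring

theorem integral_pow_mul_exp (k : ℕ) :
    ∫ x : ℝ, x ^ k * Real.exp (-(x ^ 2) / 2) = gaussMoment k * (2 * halfMoment 0) := by
  rcases Nat.even_or_odd k with hk | hk
  · have h : ∫ x : ℝ, x ^ k * Real.exp (-(x ^ 2) / 2) = 2 * halfMoment k := by
      rw [halfMoment, ← integral_comp_abs (f := fun x => x ^ k * Real.exp (-(x ^ 2) / 2))]
      simp [hk.pow_abs]
    rw [h]
    obtain ⟨m, rfl⟩ := hk.exists_two_nsmul
    clear h hk
    induction m with
    | zero => simp [gaussMoment]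
    | succ m ih =>
      rw [show 2 • (m + 1) = 2 • m + 2 by simp; ring, halfMoment_add_two, gaussMoment, mul_assoc,
        ← ih]
      ring
  · rw [gaussMoment_of_odd hk, zero_mul]
    have h := integral_neg_eq_self (fun x : ℝ => x ^ k * Real.exp (-(x ^ 2) / 2)) volume
    simp only [hk.neg_pow, neg_sq, neg_mul, integral_neg] at h
    linarith

theorem integral_monomialAt_mul_exp {n : ℕ} (K : Fin n →₀ ℕ) :
    ∫ x : EuclideanSpace ℝ (Fin n), monomialAt K x * Real.exp (-(‖x‖ ^ 2) / 2)
      = gaussMixedMoment K * (2 * halfMoment 0) ^ n := by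
  have h : ∀ x : EuclideanSpace ℝ (Fin n), monomialAt K x * Real.exp (-(‖x‖ ^ 2) / 2)
      = ∏ i, (x i ^ K i * Real.exp (-(x i ^ 2) / 2)) := by
    intro x
    rw [Finset.prod_mul_distrib, ← Real.exp_sum, monomialAt, EuclideanSpace.norm_sq_eq,
      ← Finset.sum_div, Finset.sum_neg_distrib]
    simp
  simp_rw [h]
  have h2 := (EuclideanSpace.volume_preserving_symm_measurableEquiv_toLp (Fin n)).integral_comp
    (MeasurableEquiv.measurableEmbedding _)
    (fun y : Fin n → ℝ => ∏ i, (y i ^ K i * Real.exp (-(y i ^ 2) / 2)))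
  have h3 := integral_fintype_prod_volume_eq_prod
    (fun (i : Fin n) (t : ℝ) => t ^ K i * Real.exp (-(t ^ 2) / 2))
  refine (Eq.trans ?_ h2).trans (h3.trans ?_)
  · rfl
  · simp_rw [integral_pow_mul_exp, Finset.prod_mul_distrib, gaussMixedMoment]
    simp [mul_pow]

theorem monomialAt_smul {n : ℕ} (K : Fin n →₀ ℕ) (r : ℝ) (x : EuclideanSpace ℝ (Fin n)) :
    monomialAt K (r • x) = r ^ K.degree * monomialAt K x := by
  simp [monomialAt, mul_pow, Finset.prod_mul_distrib, Finset.prod_pow_eq_pow_sum,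
    Finsupp.degree_eq_sum]

/-- The integral of a monomial over the unit sphere. -/
noncomputable def sphereMoment {n : ℕ} (K : Fin n →₀ ℕ) : ℝ :=
  ∫ w : Metric.sphere (0 : EuclideanSpace ℝ (Fin n)) 1, monomialAt K w.1
    ∂(volume : Measure (EuclideanSpace ℝ (Fin n))).toSphere

/-- Polar coordinates, stated for an arbitrary radial weight `g` so as to serve both the Gaussian
weight and the indicator of the ball. -/
theorem integral_monomialAt_mul_radial {n : ℕ} (hn : 1 ≤ n) (K : Fin n →₀ ℕ) (g : ℝ → ℝ) :
    ∫ x : EuclideanSpace ℝ (Fin n), monomialAt K x * g ‖x‖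
      = sphereMoment K * ∫ r in Set.Ioi (0 : ℝ), r ^ (n - 1 + K.degree) * g r := by
  have : Nonempty (Fin n) := ⟨⟨0, hn⟩⟩
  have hdim : Module.finrank ℝ (EuclideanSpace ℝ (Fin n)) = n := by simp
  let μ : Measure (EuclideanSpace ℝ (Fin n)) := volume
  calc
    _ = ∫ x : ({(0)}ᶜ : Set (EuclideanSpace ℝ (Fin n))), monomialAt K x.1 * g ‖x.1‖ ∂(μ.comap (↑)) := by
      rw [integral_subtype_comap (measurableSet_singleton _).compl
        fun x : EuclideanSpace ℝ (Fin n) ↦ monomialAt K x * g ‖x‖, restrict_compl_singleton]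
    _ = ∫ p, monomialAt K (p.2.1 • p.1.1) * g p.2.1
          ∂μ.toSphere.prod (.volumeIoiPow (Module.finrank ℝ (EuclideanSpace ℝ (Fin n)) - 1)) := by
      rw [← μ.measurePreserving_homeomorphUnitSphereProd.integral_comp
        (Homeomorph.measurableEmbedding _)]
      refine integral_congr_ae (Eventually.of_forall fun x => ?_)
      have hx : ‖x.1‖ ≠ 0 := norm_ne_zero_iff.mpr x.2
      simp [smul_smul, mul_inv_cancel₀ hx]
    _ = ∫ p, monomialAt K p.1.1 * (p.2.1 ^ K.degree * g p.2.1)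
          ∂μ.toSphere.prod (.volumeIoiPow (Module.finrank ℝ (EuclideanSpace ℝ (Fin n)) - 1)) := by
      refine integral_congr_ae (Eventually.of_forall fun p => ?_)
      simp only [monomialAt_smul]
      ring
    _ = sphereMoment K * ∫ r : Set.Ioi (0 : ℝ), (r.1 ^ K.degree * g r.1)
          ∂.volumeIoiPow (Module.finrank ℝ (EuclideanSpace ℝ (Fin n)) - 1) :=
      integral_prod_mul (fun w : Metric.sphere (0 : EuclideanSpace ℝ (Fin n)) 1 => monomialAt K w.1)
        (fun r : Set.Ioi (0 : ℝ) => r.1 ^ K.degree * g r.1)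
    _ = _ := by
      simp only [Measure.volumeIoiPow, ENNReal.ofReal]
      rw [integral_withDensity_eq_integral_smul, hdim,
        integral_subtype_comap measurableSet_Ioi
          fun a : ℝ ↦ Real.toNNReal (a ^ (n - 1)) • (a ^ K.degree * g a),
        setIntegral_congr_fun measurableSet_Ioi fun x hx ↦ ?_]
      · rw [NNReal.smul_def, Real.coe_toNNReal _ (pow_nonneg (le_of_lt hx) _), smul_eq_mul,
          pow_add, mul_assoc]
      · exact (measurable_subtype_coe.pow_const _).real_toNNReal

theorem setIntegral_closedBall_monomialAt {n : ℕ} (hn : 1 ≤ n) (K : Fin n →₀ ℕ) {R : ℝ}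
    (hR : 0 < R) :
    ∫ x in Metric.closedBall (0 : EuclideanSpace ℝ (Fin n)) R, monomialAt K x
      = sphereMoment K * (R ^ (n + K.degree) / (n + K.degree)) := by
  have h1 : ∫ x in Metric.closedBall (0 : EuclideanSpace ℝ (Fin n)) R, monomialAt K x
      = ∫ x : EuclideanSpace ℝ (Fin n), monomialAt K x * (Set.Iic R).indicator 1 ‖x‖ := by
    rw [← integral_indicator Metric.isClosed_closedBall.measurableSet]
    refine integral_congr_ae (Eventually.of_forall fun x => ?_)
    by_cases h : ‖x‖ ≤ R <;> simp [h]
  have h2 : ∫ r in Set.Ioi (0 : ℝ), r ^ (n - 1 + K.degree) * (Set.Iic R).indicator 1 r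
      = ∫ r in (0 : ℝ)..R, r ^ (n - 1 + K.degree) := by
    rw [intervalIntegral.integral_of_le hR.le, ← Set.Ioi_inter_Iic,
      ← setIntegral_indicator measurableSet_Iic]
    refine integral_congr_ae (Eventually.of_forall fun x => ?_)
    simp [Set.indicator_apply]
  have h3 : n - 1 + K.degree + 1 = n + K.degree := by omega
  rw [h1, integral_monomialAt_mul_radial hn, h2, integral_pow, h3]
  congr 2
  · rw [zero_pow (by omega), sub_zero]
  · exact_mod_cast h3

theorem halfMoment_add_two_mul {n : ℕ} (hn : 1 ≤ n) (d : ℕ) :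
    halfMoment (n - 1 + 2 * d)
      = (∏ j ∈ Finset.range d, ((n : ℝ) + 2 * j)) * halfMoment (n - 1) := by
  induction d with
  | zero => simp
  | succ d ih =>
    rw [show n - 1 + 2 * (d + 1) = n - 1 + 2 * d + 2 by ring, halfMoment_add_two, ih,
      Finset.prod_range_succ]
    push_cast [Nat.cast_sub hn]
    ring

/-- The Gaussian integral of `x^K` computed twice, coordinate by coordinate and in polar
coordinates. It determines the spherical moments without the area of the sphere. -/
theorem sphereMoment_mul_halfMoment {n : ℕ} (hn : 1 ≤ n) (K : Fin n →₀ ℕ) :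
    sphereMoment K * halfMoment (n - 1 + K.degree)
      = gaussMixedMoment K * (2 * halfMoment 0) ^ n := by
  rw [← integral_monomialAt_mul_exp, halfMoment,
    integral_monomialAt_mul_radial hn K fun r => Real.exp (-(r ^ 2) / 2)]

theorem gaussMixedMoment_zero (n : ℕ) : gaussMixedMoment (0 : Fin n →₀ ℕ) = 1 := by
  simp [gaussMixedMoment, gaussMoment]

theorem integral_uniformBall_monomialAt {n : ℕ} (hn : 1 ≤ n) (K : Fin n →₀ ℕ) {R : ℝ}
    (hR : 0 < R) : ∫ x, monomialAt K x ∂uniformBall n R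
      = (sphereMoment (0 : Fin n →₀ ℕ) * (R ^ n / n))⁻¹
        * (sphereMoment K * (R ^ (n + K.degree) / (n + K.degree))) := by
  rw [uniformBall, ProbabilityTheory.cond, integral_smul_measure,
    setIntegral_closedBall_monomialAt hn K hR, smul_eq_mul]
  congr 1
  have := setIntegral_closedBall_monomialAt hn 0 hR
  simp only [monomialAt, Finsupp.coe_zero, Pi.zero_apply, pow_zero, Finset.prod_const_one,
    map_zero, add_zero, Nat.cast_zero] at this
  rw [← this]
  simp [Measure.real]

theorem mul_prod_range_add_two_mul_succ (n d : ℕ) :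
    (n : ℝ) * ∏ j ∈ Finset.range d, ((n : ℝ) + 2 * (j + 1))
      = (∏ j ∈ Finset.range d, ((n : ℝ) + 2 * j)) * (n + 2 * d) := by
  have := Finset.prod_range_succ (fun j : ℕ => (n : ℝ) + 2 * j) d
  rw [← this, Finset.prod_range_succ']
  push_cast
  ring

/-- Relative to degree zero, the spherical moment contributes `1 / (n(n+2)⋯(n+2d-2))` and the radial
integral `n / (n + 2d)`; together they shift the product to `(n+2)⋯(n+2d)`. -/
theorem integral_monomialAt_even {n : ℕ} (hn : 1 ≤ n) {d : ℕ} {K : Fin n →₀ ℕ}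
    (hK : K.degree = 2 * d) {R : ℝ} (hR : 0 < R) : ∫ x, monomialAt K x ∂uniformBall n R
      = gaussMixedMoment K * (R ^ (2 * d) / ∏ j ∈ Finset.range d, ((n : ℝ) + 2 * (j + 1))) := by
  have hn0 : (0 : ℝ) < n := by exact_mod_cast hn
  have h0 := sphereMoment_mul_halfMoment hn 0
  have h1 := sphereMoment_mul_halfMoment hn K
  rw [map_zero, add_zero, gaussMixedMoment_zero, one_mul] at h0
  have hH := halfMoment_pos (n - 1)
  have hpos : 0 < sphereMoment (0 : Fin n →₀ ℕ) := by
    have : 0 < (2 * halfMoment 0) ^ n := pow_pos (mul_pos two_pos (halfMoment_pos 0)) _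
    rw [← h0] at this
    exact pos_of_mul_pos_left this hH.le
  have hP : 0 < ∏ j ∈ Finset.range d, ((n : ℝ) + 2 * j) :=
    Finset.prod_pos fun j _ => by positivity
  have hP' : 0 < ∏ j ∈ Finset.range d, ((n : ℝ) + 2 * (j + 1)) :=
    Finset.prod_pos fun j _ => by positivity
  have h2 : sphereMoment K * (∏ j ∈ Finset.range d, ((n : ℝ) + 2 * j))
      = gaussMixedMoment K * sphereMoment (0 : Fin n →₀ ℕ) := by
    rw [← h0, hK, halfMoment_add_two_mul hn] at h1
    refine mul_right_cancel₀ hH.ne' ?_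
    linarith
  rw [integral_uniformBall_monomialAt hn K hR, hK]
  have h3 : sphereMoment K = gaussMixedMoment K * sphereMoment (0 : Fin n →₀ ℕ)
      / ∏ j ∈ Finset.range d, ((n : ℝ) + 2 * j) := by
    rw [eq_div_iff hP.ne', h2]
  have h4 : ∏ j ∈ Finset.range d, ((n : ℝ) + 2 * (j + 1))
      = (∏ j ∈ Finset.range d, ((n : ℝ) + 2 * j)) * (n + 2 * d) / n := by
    rw [eq_div_iff hn0.ne', ← mul_prod_range_add_two_mul_succ, mul_comm]
  rw [h3, h4]
  push_cast
  rw [pow_add]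
  field_simp

theorem integral_monomialAt_odd {n : ℕ} (hn : 1 ≤ n) {K : Fin n →₀ ℕ}
    (hK : Odd K.degree) {R : ℝ} (hR : 0 < R) : ∫ x, monomialAt K x ∂uniformBall n R = 0 := by
  have h1 := sphereMoment_mul_halfMoment hn K
  rw [gaussMixedMoment_of_odd_degree hK, zero_mul] at h1
  have h2 := (mul_eq_zero.mp h1).resolve_right (halfMoment_pos _).ne'
  rw [integral_uniformBall_monomialAt hn K hR, h2, zero_mul, mul_zero]

theorem gaussMixedMoment_single_two {n : ℕ} (j : Fin n) :
    gaussMixedMoment (Finsupp.single j 2) = 1 := by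
  have := gaussMixedMoment_add_single (Finsupp.single j 1) j
  rw [← Finsupp.single_add] at this
  rw [this]
  simp [gaussMixedMoment_zero]

/-- The variance of one coordinate on the ball is `R² / (n + 2)`. -/
theorem sq_eq_of_isIsotropicRadius {n : ℕ} (hn : 1 ≤ n) {R : ℝ} (h : IsIsotropicRadius n R) :
    R ^ 2 = n + 2 := by
  obtain ⟨hR, h1, h2⟩ := h
  have h3 := h2 ⟨0, hn⟩ ⟨0, hn⟩
  rw [if_pos rfl, ProbabilityTheory.covariance, h1] at h3
  have h4 : ∀ x : EuclideanSpace ℝ (Fin n), (x ⟨0, hn⟩ - 0) * (x ⟨0, hn⟩ - 0)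
      = monomialAt (Finsupp.single ⟨0, hn⟩ 2) x := by
    intro x
    rw [monomialAt, Finset.prod_eq_single ⟨0, hn⟩]
    · simp; ring
    · intro j _ hj
      simp [hj.symm]
    · simp
  simp only [h4] at h3
  rw [integral_monomialAt_even hn (d := 1) (by simp) hR] at h3
  rw [gaussMixedMoment_single_two] at h3
  have hn0 : (0 : ℝ) < n + 2 := by positivity
  simp at h3
  field_simp at h3
  linarith

end TensorCov

/-! ### The spectrum of `C̃`. -/

namespace TensorCov

open MvPolynomial

/-- The ratio between the moments of degree `2 d` of the ball of radius `R` and those of the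
standard Gaussian measure. -/
noncomputable def ballMomentRatio (n d : ℕ) (R : ℝ) : ℝ :=
  R ^ (2 * d) / ∏ j ∈ Finset.range d, ((n : ℝ) + 2 * (j + 1))

theorem tensorCov_apply_of_odd {n d : ℕ} (hn : 1 ≤ n) (hd : Odd d) {R : ℝ} (hR : 0 < R)
    (I J : MultiIndex n d) : tensorCov d (uniformBall n R) I J
      = ballMomentRatio n d R * gaussMixedMoment (I.1 + J.1) := by
  have hI := MultiIndex.degree_eq I
  have hJ := MultiIndex.degree_eq J
  rw [tensorCov, Matrix.of_apply, integral_monomialAt_odd hn (K := I.1) (by rwa [hI]) hR,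
    integral_monomialAt_even hn (K := I.1 + J.1) (d := d) (by rw [map_add, hI, hJ, two_mul]) hR,
    ballMomentRatio]
  ring

theorem tensorCov_apply_of_even {n m : ℕ} (hn : 1 ≤ n) {R : ℝ} (hR : 0 < R)
    (I J : MultiIndex n (2 * m)) : tensorCov (2 * m) (uniformBall n R) I J
      = ballMomentRatio n (2 * m) R * gaussMixedMoment (I.1 + J.1)
        - ballMomentRatio n m R ^ 2 * (gaussMixedMoment I.1 * gaussMixedMoment J.1) := by
  have hI := MultiIndex.degree_eq I
  have hJ := MultiIndex.degree_eq J
  rw [tensorCov, Matrix.of_apply, integral_monomialAt_even hn hI hR,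
    integral_monomialAt_even hn hJ hR,
    integral_monomialAt_even hn (K := I.1 + J.1) (d := 2 * m)
      (by rw [map_add, hI, hJ, ← two_mul]) hR,
    ballMomentRatio, ballMomentRatio]
  ring

/-- The coefficient of `|x|^{2k} Δ^k` in the operator with matrix `C̃`. -/
noncomputable def covCoeff (n d : ℕ) (R : ℝ) (k : ℕ) : ℝ :=
  (ballMomentRatio n d R - if d = 2 * k then ballMomentRatio n k R ^ 2 else 0) * heatCoeff k ^ 2

theorem multiFactorial_pos {n : ℕ} (I : Fin n →₀ ℕ) : 0 < multiFactorial I :=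
  Finset.prod_pos fun j _ => by exact_mod_cast Nat.factorial_pos _

theorem tensorCov_apply {n d : ℕ} (hn : 1 ≤ n) {R : ℝ} (hR : 0 < R) (I J : MultiIndex n d) :
    tensorCov d (uniformBall n R) I J = multiFactorial I.1 *
      coeff I.1 (radialOp n (d + 1) (covCoeff n d R) (monomial J.1 1)) := by
  rcases Nat.even_or_odd d with hd | hd
  · obtain ⟨m, hm⟩ := hd
    rw [← two_mul] at hm
    subst hm
    have h : radialOp n (2 * m + 1) (covCoeff n (2 * m) R) (monomial J.1 1)
        = ballMomentRatio n (2 * m) R •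
            radialOp n (2 * m + 1) (fun k => heatCoeff k ^ 2) (monomial J.1 1)
          - ballMomentRatio n m R ^ 2 •
            (heatCoeff m ^ 2 • (rsq n ^ m * (lap n ^ m) (monomial J.1 1))) := by
      simp only [radialOp_apply, covCoeff, sub_mul, sub_smul, Finset.sum_sub_distrib,
        Finset.smul_sum, smul_smul]
      congr 1
      rw [Finset.sum_eq_single_of_mem m (by simp; omega)]
      · simp
      · intro k _ hk
        rw [if_neg (by omega)]
        simp
    rw [tensorCov_apply_of_even hn hR, gaussMixedMoment_add (Nat.lt_succ_self _),
      gaussMixedMoment_mul, h, coeff_sub, coeff_smul _ (ballMomentRatio n (2 * m) R),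
      coeff_smul _ (ballMomentRatio n m R ^ 2), smul_eq_mul, smul_eq_mul]
    ring
  · have h : radialOp n (d + 1) (covCoeff n d R) (monomial J.1 1) = ballMomentRatio n d R •
        radialOp n (d + 1) (fun k => heatCoeff k ^ 2) (monomial J.1 1) := by
      simp only [radialOp_apply, Finset.smul_sum, smul_smul]
      refine Finset.sum_congr rfl fun k _ => ?_
      rw [covCoeff, if_neg, sub_zero]
      rintro rfl
      exact Nat.not_odd_iff_even.mpr (even_two_mul k) hd
    rw [tensorCov_apply_of_odd hn hd hR, gaussMixedMoment_add (Nat.lt_succ_self _), h,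
      coeff_smul, smul_eq_mul]
    ring

theorem tensorCovTilde_eq {n d : ℕ} (hn : 1 ≤ n) {R : ℝ} (hR : 0 < R) :
    tensorCovTilde d (uniformBall n R)
      = coefMat d d (radialOp n (d + 1) (covCoeff n d R)) := by
  ext I J
  rw [tensorCovTilde, Matrix.of_apply, tensorCov_apply hn hR, coefMat, Matrix.of_apply]
  exact mul_div_cancel_left₀ _ (multiFactorial_pos I.1).ne'

/-- The product `2 ^ k k! n (n + 2) ⋯ (n + 2 k - 2)`, which is `Δ ^ k |x| ^ {2 k}`. -/
noncomputable def lapNorm (n k : ℕ) : ℝ :=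
  ∏ j ∈ Finset.range k, (2 * (j + 1) * ((n : ℝ) + 2 * j))

theorem lapNorm_pos {n : ℕ} (hn : 1 ≤ n) (k : ℕ) : 0 < lapNorm n k := by
  have hn0 : (0 : ℝ) < n := by exact_mod_cast hn
  exact Finset.prod_pos fun j _ => by positivity

theorem lapNorm_succ (n k : ℕ) :
    lapNorm n (k + 1) = lapNorm n k * (2 * (k + 1) * ((n : ℝ) + 2 * k)) := by
  rw [lapNorm, Finset.prod_range_succ, lapNorm]

theorem lapNorm_eq (n k : ℕ) :
    lapNorm n k = 2 ^ k * (k ! : ℝ) * ∏ j ∈ Finset.range k, ((n : ℝ) + 2 * j) := by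
  induction k with
  | zero => simp [lapNorm]
  | succ k ih =>
    rw [lapNorm_succ, ih, Finset.prod_range_succ, Nat.factorial_succ]
    push_cast
    ring

/-- The coefficient of `|x|^{2k} Δ^k` in the restriction of the operator with matrix `C̃` to
`|x|^{2i} P_{d-2i} ≃ P_{d-2i}`. -/
noncomputable def iterCoeff (n d : ℕ) (R : ℝ) (i k : ℕ) : ℝ :=
  ballMomentRatio n d R * ((∏ j ∈ Finset.range i, ((n : ℝ) + 2 * d - 2 * (j + 1)))
      / (2 ^ i * 4 ^ k * (k ! : ℝ) * ((k + i)! : ℝ)))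
    - if d = 2 * (k + i) then
        ballMomentRatio n (k + i) R ^ 2 * (lapNorm n (k + i) / lapNorm n k * heatCoeff (k + i) ^ 2)
      else 0

theorem iterCoeff_zero {n : ℕ} (hn : 1 ≤ n) (d : ℕ) (R : ℝ) :
    iterCoeff n d R 0 = covCoeff n d R := by
  ext k
  have h : heatCoeff k ^ 2 = 1 / (4 ^ k * (k ! : ℝ) * (k ! : ℝ)) := by
    rw [heatCoeff, show (4 : ℝ) = 2 ^ 2 by norm_num, ← pow_mul, mul_comm 2 k, pow_mul, one_div]
    ring
  rw [iterCoeff, covCoeff, sub_mul, ite_mul, zero_mul, Finset.prod_range_zero, pow_zero, one_mul,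
    add_zero, div_self (lapNorm_pos hn k).ne', one_mul, h]

/-- For the part coming from `E[x^(I+J)]`, put everything over `2^(i+1) 4^k k! (k+i+1)!`: the
recursion becomes `n + 2d - 2i - 2 = 2(k+i+1) + (n + 2(d-2i-2) - 2k)`. For the part coming from the
means, on forms `g` of degree `2k` one has `Δ^(k+i) (|x|^(2i) g) = (lapNorm n (k+i) / lapNorm n k)
Δ^k g`, and these ratios multiply along the descent. -/
theorem iterCoeff_succ {n : ℕ} (hn : 1 ≤ n) (d : ℕ) (R : ℝ) {i k : ℕ}
    (hk : 2 * i + 2 + 2 * k ≤ d) :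
    iterCoeff n d R (i + 1) k = iterCoeff n d R i k
      + 2 * (k + 1) * (n + 2 * (d - 2 * i - 2) - 2 * k) * iterCoeff n d R i (k + 1) := by
  have e1 : k + (i + 1) = k + i + 1 := by ring
  have e2 : k + 1 + i = k + i + 1 := by ring
  have h1 : (∏ j ∈ Finset.range (i + 1), ((n : ℝ) + 2 * d - 2 * (j + 1)))
        / (2 ^ (i + 1) * 4 ^ k * (k ! : ℝ) * ((k + i + 1)! : ℝ))
      = (∏ j ∈ Finset.range i, ((n : ℝ) + 2 * d - 2 * (j + 1)))
          / (2 ^ i * 4 ^ k * (k ! : ℝ) * ((k + i)! : ℝ))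
        + 2 * (k + 1) * (n + 2 * (d - 2 * i - 2) - 2 * k) *
        ((∏ j ∈ Finset.range i, ((n : ℝ) + 2 * d - 2 * (j + 1)))
          / (2 ^ i * 4 ^ (k + 1) * ((k + 1)! : ℝ) * ((k + i + 1)! : ℝ))) := by
    rw [Finset.prod_range_succ, Nat.factorial_succ, Nat.factorial_succ]
    generalize (∏ j ∈ Finset.range i, ((n : ℝ) + 2 * d - 2 * (j + 1))) = p
    push_cast
    field_simp
    ring
  simp only [iterCoeff, e1, e2]
  rw [h1]
  -- As `2(k + i + 1) ≤ d`, the mean correction cannot occur in `iterCoeff n d R i k`, only at index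
  -- `k + 1`.
  have hd' : d ≠ 2 * (k + i) := by omega
  rw [if_neg hd', sub_zero]
  by_cases hd : d = 2 * (k + i + 1)
  · have hL := lapNorm_pos hn k
    have hn0 : (0 : ℝ) < n := by exact_mod_cast hn
    have hc : (n : ℝ) + 2 * (d - 2 * i - 2) - 2 * k = n + 2 * k := by
      rw [hd]; push_cast; ring
    have h2 : lapNorm n (k + i + 1) / lapNorm n k
        = 2 * (k + 1) * (n + 2 * k) * (lapNorm n (k + i + 1) / lapNorm n (k + 1)) := by
      have : (n : ℝ) + 2 * k ≠ 0 := by positivity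
      rw [lapNorm_succ n k]
      field_simp
    rw [if_pos hd, if_pos hd, hc, h2]
    ring
  · rw [if_neg hd, if_neg hd]
    ring

theorem prod_range_add_two_mul (n d : ℕ) {i : ℕ} (hi : i ≤ d) :
    ∏ j ∈ Finset.range d, ((n : ℝ) + 2 * j) = (∏ j ∈ Finset.range (d - i), ((n : ℝ) + 2 * j))
      * ∏ j ∈ Finset.range i, ((n : ℝ) + 2 * d - 2 * (j + 1)) := by
  induction i with
  | zero => simp
  | succ i ih =>
    rw [ih (by omega), show d - i = d - (i + 1) + 1 by omega, Finset.prod_range_succ,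
      Finset.prod_range_succ _ i, Nat.cast_sub hi]
    push_cast
    ring

theorem prod_range_add_two_mul_succ {n : ℕ} (hn : 1 ≤ n) (i : ℕ) :
    ∏ j ∈ Finset.range i, ((n : ℝ) + 2 * (j + 1))
      = (∏ j ∈ Finset.range i, ((n : ℝ) + 2 * j)) * (n + 2 * i) / n := by
  have hn0 : (n : ℝ) ≠ 0 := by exact_mod_cast (by omega : n ≠ 0)
  rw [eq_div_iff hn0, ← mul_prod_range_add_two_mul_succ, mul_comm]

theorem prod_range_sub_two_mul (n i : ℕ) :
    ∏ j ∈ Finset.range i, (((2 * i : ℕ) : ℝ) + n - 2 * j)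
      = ∏ j ∈ Finset.range i, ((n : ℝ) + 2 * (j + 1)) := by
  rw [← Finset.prod_range_reflect]
  refine Finset.prod_congr rfl fun j hj => ?_
  rw [Finset.mem_range] at hj
  rw [Nat.sub_sub, Nat.cast_sub (by omega)]
  push_cast
  ring

theorem iterCoeff_eq_etaValue {n : ℕ} (hn : 1 ≤ n) {d i : ℕ} (hi : 2 * i ≤ d) (R : ℝ) :
    iterCoeff n d R i 0 = etaValue n d R i := by
  have hn0 : (0 : ℝ) < n := by exact_mod_cast hn
  have hA : 0 < ∏ j ∈ Finset.range (d - i), ((n : ℝ) + 2 * j) :=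
    Finset.prod_pos fun j _ => by positivity
  have hW : 0 < ∏ j ∈ Finset.range i, ((n : ℝ) + 2 * d - 2 * (j + 1)) := by
    refine Finset.prod_pos fun j hj => ?_
    have h1 : j + 1 ≤ d := by rw [Finset.mem_range] at hj; omega
    have h2 : ((j : ℝ) + 1) ≤ d := by exact_mod_cast h1
    linarith
  have hκ : ballMomentRatio n d R = R ^ (2 * d) * n
      / ((∏ j ∈ Finset.range (d - i), ((n : ℝ) + 2 * j))
        * (∏ j ∈ Finset.range i, ((n : ℝ) + 2 * d - 2 * (j + 1))) * (n + 2 * d)) := by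
    rw [ballMomentRatio, ← prod_range_add_two_mul n d (by omega),
      ← mul_prod_range_add_two_mul_succ, mul_comm (R ^ (2 * d)), mul_div_mul_left _ _ hn0.ne']
  rw [iterCoeff, hκ, etaValue]
  simp only [zero_add, pow_zero, mul_one, Nat.factorial_zero, Nat.cast_one]
  rcases Nat.lt_or_ge (2 * i) d with h | h
  · rw [if_neg (by omega), if_pos h, sub_zero]
    field_simp
  -- At the last index both parts of `iterCoeff` contribute; the numerator `d²` of `etaValue` is `(n
  -- + d)² - n (n + 2d)`.
  · obtain rfl : d = 2 * i := by omega
    rw [if_pos rfl, if_neg (by omega), show 2 * i - i = i by omega] at *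
    rw [show 2 * i / 2 = i by omega, lapNorm_eq, lapNorm, Finset.prod_range_zero, div_one,
      ballMomentRatio, heatCoeff]
    rw [prod_range_sub_two_mul, prod_range_add_two_mul_succ hn]
    generalize (∏ j ∈ Finset.range i, ((n : ℝ) + 2 * j)) = A at *
    generalize (∏ j ∈ Finset.range i, ((n : ℝ) + 2 * ((2 * i : ℕ) : ℝ) - 2 * (j + 1))) = W at *
    push_cast
    field_simp
    ring

theorem charpoly_tensorCovTilde {n : ℕ} (hn : 1 ≤ n) (d : ℕ) {R : ℝ} (hR : 0 < R) :
    (tensorCovTilde d (uniformBall n R)).charpoly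
      = ∏ i ∈ Finset.range (d / 2 + 1),
        (Polynomial.X - Polynomial.C (etaValue n d R i)) ^ harmonicDim n (d - 2 * i) := by
  rw [tensorCovTilde_eq hn hR, ← iterCoeff_zero hn,
    charpoly_radialOp hn d (d + 1) (iterCoeff n d R) (by omega)
      fun i k hi => iterCoeff_succ hn d R hi]
  refine Finset.prod_congr rfl fun i hi => ?_
  rw [iterCoeff_eq_etaValue hn (by rw [Finset.mem_range] at hi; omega)]

theorem roots_charpoly_tensorCovTilde {n : ℕ} (hn : 1 ≤ n) (d : ℕ) {R : ℝ} (hR : 0 < R) :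
    (tensorCovTilde d (uniformBall n R)).charpoly.roots
      = ∑ i ∈ Finset.range (d / 2 + 1),
        Multiset.replicate (harmonicDim n (d - 2 * i)) (etaValue n d R i) := by
  rw [charpoly_tensorCovTilde hn d hR, Polynomial.roots_prod]
  · simp only [Polynomial.roots_pow, Polynomial.roots_X_sub_C, Multiset.nsmul_singleton]
    rfl
  · exact Finset.prod_ne_zero_iff.mpr fun i _ => pow_ne_zero _ (Polynomial.X_sub_C_ne_zero _)

end TensorCov

/-! ### Sorted eigenvalues of symmetric matrices and min-max. -/

namespace TensorCov

section Eigenvalues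

variable {ι : Type*} [Fintype ι] [DecidableEq ι]

theorem length_sortedEigenvalues {A : Matrix ι ι ℝ} (hA : A.IsHermitian) :
    (sortedEigenvalues A).length = Fintype.card ι := by
  rw [sortedEigenvalues, Multiset.length_sort, hA.roots_charpoly_eq_eigenvalues]
  simp

theorem getElem_mem_roots {A : Matrix ι ι ℝ} {i : ℕ} (h1 : 1 ≤ i)
    (h2 : i ≤ (sortedEigenvalues A).length) : eigenvalueAt A i ∈ A.charpoly.roots := by
  rw [eigenvalueAt, List.getD_eq_getElem _ _ (by omega), ← Multiset.mem_sort (· ≤ ·)]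
  exact List.getElem_mem _

theorem eigenvalueAt_mono {A : Matrix ι ι ℝ} {i j : ℕ} (h1 : 1 ≤ i) (hij : i ≤ j)
    (hj : j ≤ (sortedEigenvalues A).length) : eigenvalueAt A i ≤ eigenvalueAt A j := by
  rw [eigenvalueAt, eigenvalueAt, List.getD_eq_getElem _ _ (by omega),
    List.getD_eq_getElem _ _ (by omega)]
  exact (Multiset.pairwise_sort A.charpoly.roots (· ≤ ·)).rel_get_of_le
    (a := ⟨i - 1, by simp only [sortedEigenvalues] at hj; omega⟩)
    (b := ⟨j - 1, by simp only [sortedEigenvalues] at hj; omega⟩) (by simp; omega)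

theorem eigenvalueAt_one_le {A : Matrix ι ι ℝ} {a : ℝ} (ha : a ∈ A.charpoly.roots) :
    eigenvalueAt A 1 ≤ a := by
  rw [← Multiset.mem_sort (· ≤ ·)] at ha
  obtain ⟨k, hk, rfl⟩ := List.mem_iff_getElem.mp ha
  have h := eigenvalueAt_mono (A := A) (i := 1) (j := k + 1) le_rfl (by omega) hk
  refine h.trans (le_of_eq ?_)
  exact List.getD_eq_getElem _ _ hk

theorem eigenvalueAt_eq_eigenvalues₀ {A : Matrix ι ι ℝ} (hA : A.IsHermitian) {i : ℕ}
    (h1 : 1 ≤ i) (h2 : i ≤ Fintype.card ι) :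
    eigenvalueAt A i = hA.eigenvalues₀ ⟨Fintype.card ι - i, by omega⟩ := by
  -- `eigenvalues₀` is decreasing and indexed from `0`, so the `i`-th smallest value sits at index
  -- `card - i`.
  have h : sortedEigenvalues A = (List.ofFn hA.eigenvalues₀).reverse := by
    rw [← hA.sort_roots_charpoly_eq_eigenvalues₀, sortedEigenvalues]
    refine List.Perm.eq_of_pairwise' (Multiset.pairwise_sort _ _)
      (List.pairwise_reverse.mpr (Multiset.pairwise_sort _ _)) ?_
    rw [← Multiset.coe_eq_coe, Multiset.coe_reverse, Multiset.sort_eq, Multiset.sort_eq]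
    simp
  have hl : i - 1 < (sortedEigenvalues A).length := by
    rw [length_sortedEigenvalues hA]; omega
  rw [eigenvalueAt, List.getD_eq_getElem _ _ hl]
  simp only [h, List.getElem_reverse, List.getElem_ofFn]
  congr 2
  simp
  omega

theorem sum_sq_dotProduct_eigenvectorBasis {A : Matrix ι ι ℝ} (hA : A.IsHermitian) (x : ι → ℝ) :
    ∑ j, ((hA.eigenvectorBasis j).ofLp ⬝ᵥ x) ^ 2 = x ⬝ᵥ x := by
  have h := hA.eigenvectorBasis.sum_inner_mul_inner (WithLp.toLp 2 x) (WithLp.toLp 2 x)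
  simp only [EuclideanSpace.inner_eq_star_dotProduct, star_trivial] at h
  rw [← h]
  exact Finset.sum_congr rfl fun j _ => by rw [sq, dotProduct_comm x]

theorem sum_eigenvalues_mul_sq {A : Matrix ι ι ℝ} (hA : A.IsHermitian) (x : ι → ℝ) :
    ∑ j, hA.eigenvalues j * ((hA.eigenvectorBasis j).ofLp ⬝ᵥ x) ^ 2 = x ⬝ᵥ A.mulVec x := by
  have h := hA.eigenvectorBasis.sum_inner_mul_inner (WithLp.toLp 2 x) (WithLp.toLp 2 (A.mulVec x))
  simp only [EuclideanSpace.inner_eq_star_dotProduct, star_trivial] at h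
  rw [dotProduct_comm, ← h]
  refine Finset.sum_congr rfl fun j _ => ?_
  have hT : A.transpose = A := by
    rw [← Matrix.conjTranspose_eq_transpose_of_trivial, hA.eq]
  have h2 : A.mulVec x ⬝ᵥ (hA.eigenvectorBasis j).ofLp
      = hA.eigenvalues j * ((hA.eigenvectorBasis j).ofLp ⬝ᵥ x) := by
    rw [dotProduct_comm, Matrix.dotProduct_mulVec, ← Matrix.mulVec_transpose, hT,
      hA.mulVec_eigenvectorBasis, smul_dotProduct, smul_eq_mul]
  rw [h2]
  ring

/-- A min-max comparison of the `i`-th eigenvalues of two symmetric matrices. -/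
theorem exists_quadForm_compare {A B : Matrix ι ι ℝ} (hA : A.IsHermitian) (hB : B.IsHermitian)
    (P : Matrix ι ι ℝ) {i : ℕ} (h1 : 1 ≤ i) (h2 : i ≤ Fintype.card ι) :
    ∃ x : ι → ℝ, x ≠ 0 ∧ x ⬝ᵥ A.mulVec x ≤ eigenvalueAt A i * (x ⬝ᵥ x) ∧
      eigenvalueAt B i * (P.mulVec x ⬝ᵥ P.mulVec x) ≤ P.mulVec x ⬝ᵥ B.mulVec (P.mulVec x) := by
  rw [eigenvalueAt_eq_eigenvalues₀ hA h1 h2, eigenvalueAt_eq_eigenvalues₀ hB h1 h2]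
  set k : Fin (Fintype.card ι) := ⟨Fintype.card ι - i, by omega⟩
  let e : Fin (Fintype.card ι) ≃ ι := Fintype.equivOfCardEq (Fintype.card_fin _)
  -- Ask `x` to be orthogonal to the eigenvectors of `A` before position `k` (the larger
  -- eigenvalues), and `P x` to those of `B` after `k` (the smaller ones). Position `k` is skipped,
  -- so there is one condition fewer than the dimension and a nonzero solution exists.
  let F : (ι → ℝ) →ₗ[ℝ] ({j : Fin (Fintype.card ι) // j ≠ k} → ℝ) :=
    LinearMap.pi fun j => if j.1 < k
      then dotProductBilin ℝ ℝ (hA.eigenvectorBasis (e j.1)).ofLp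
      else (dotProductBilin ℝ ℝ (hB.eigenvectorBasis (e j.1)).ofLp).comp (Matrix.toLin' P)
  have hF : LinearMap.ker F ≠ ⊥ := by
    refine LinearMap.ker_ne_bot_of_finrank_lt ?_
    rw [Module.finrank_fintype_fun_eq_card, Module.finrank_fintype_fun_eq_card,
      Fintype.card_subtype_compl, Fintype.card_fin, Fintype.card_subtype_eq]
    omega
  obtain ⟨x, hx, hx0⟩ := (Submodule.ne_bot_iff _).mp hF
  have hx' := LinearMap.mem_ker.mp hx
  refine ⟨x, hx0, ?_, ?_⟩
  · rw [← sum_eigenvalues_mul_sq hA, ← sum_sq_dotProduct_eigenvectorBasis hA, Finset.mul_sum]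
    refine Finset.sum_le_sum fun j _ => ?_
    obtain ⟨j, rfl⟩ := e.surjective j
    have hj : hA.eigenvalues (e j) = hA.eigenvalues₀ j := by
      simp [Matrix.IsHermitian.eigenvalues, e]
    rcases lt_or_ge j k with hlt | hge
    · have := congrFun hx' ⟨j, hlt.ne⟩
      simp only [F, LinearMap.pi_apply, if_pos hlt] at this
      simp only [dotProductBilin_apply_apply, Pi.zero_apply] at this
      simp [this]
    · rw [hj]
      exact mul_le_mul_of_nonneg_right (hA.eigenvalues₀_antitone hge) (sq_nonneg _)
  · rw [← sum_eigenvalues_mul_sq hB, ← sum_sq_dotProduct_eigenvectorBasis hB, Finset.mul_sum]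
    refine Finset.sum_le_sum fun j _ => ?_
    obtain ⟨j, rfl⟩ := e.surjective j
    have hj : hB.eigenvalues (e j) = hB.eigenvalues₀ j := by
      simp [Matrix.IsHermitian.eigenvalues, e]
    rcases lt_or_ge k j with hlt | hge
    · have := congrFun hx' ⟨j, hlt.ne'⟩
      simp only [F, LinearMap.pi_apply, if_neg (not_lt_of_gt hlt)] at this
      simp only [LinearMap.comp_apply, Matrix.toLin'_apply, dotProductBilin_apply_apply,
        Pi.zero_apply] at this
      simp [this]
    · rw [hj]
      exact mul_le_mul_of_nonneg_right (hB.eigenvalues₀_antitone hge) (sq_nonneg _)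

theorem mul_dotProduct_self_le {A : Matrix ι ι ℝ} (hA : A.IsHermitian) {a : ℝ}
    (ha : ∀ b ∈ A.charpoly.roots, a ≤ b) (x : ι → ℝ) : a * (x ⬝ᵥ x) ≤ x ⬝ᵥ A.mulVec x := by
  rw [← sum_eigenvalues_mul_sq hA, ← sum_sq_dotProduct_eigenvectorBasis hA, Finset.mul_sum]
  refine Finset.sum_le_sum fun j _ => mul_le_mul_of_nonneg_right (ha _ ?_) (sq_nonneg _)
  rw [hA.roots_charpoly_eq_eigenvalues]
  exact Multiset.mem_map_of_mem _ (Finset.mem_univ j)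

theorem mem_roots_charpoly_iff {A : Matrix ι ι ℝ} {a : ℝ} :
    a ∈ A.charpoly.roots ↔ ∃ x : ι → ℝ, x ≠ 0 ∧ A.mulVec x = a • x := by
  have h := Matrix.charpoly_toLin' A
  rw [← h, Polynomial.mem_roots (LinearMap.charpoly_monic _).ne_zero,
    ← Module.End.hasEigenvalue_iff_isRoot_charpoly]
  constructor
  · intro ha
    obtain ⟨x, hx⟩ := ha.exists_hasEigenvector
    exact ⟨x, hx.2, by simpa using hx.apply_eq_smul⟩
  · rintro ⟨x, hx0, hx⟩
    exact Module.End.hasEigenvalue_of_hasEigenvector (x := x)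
      ⟨Module.End.mem_eigenspace_iff.mpr (by simpa using hx), hx0⟩

end Eigenvalues

end TensorCov

/-! ### Dividing the rows of a symmetric matrix by positive weights. -/

namespace TensorCov

/-- The symmetric matrix `f_I^{-1/2} C_{IJ} f_J^{-1/2}`. -/
noncomputable def symScale {ι : Type*} (C : Matrix ι ι ℝ) (f : ι → ℝ) : Matrix ι ι ℝ :=
  Matrix.of fun I J => C I J / (√(f I) * √(f J))

theorem isHermitian_symScale {ι : Type*} {C : Matrix ι ι ℝ} (hC : C.IsHermitian) (f : ι → ℝ) :
    (symScale C f).IsHermitian := by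
  ext I J
  have := hC.apply I J
  simp only [star_trivial] at this
  simp [symScale, this, mul_comm]

theorem quadForm_symScale {ι : Type*} [Fintype ι] (C : Matrix ι ι ℝ) {f : ι → ℝ} (hf : ∀ I, 0 < f I) (y : ι → ℝ) :
    y ⬝ᵥ (symScale C f).mulVec y
      = (fun I => y I / √(f I)) ⬝ᵥ C.mulVec (fun I => y I / √(f I)) := by
  simp only [dotProduct, Matrix.mulVec, symScale, Matrix.of_apply, Finset.mul_sum]
  refine Finset.sum_congr rfl fun I _ => Finset.sum_congr rfl fun J _ => ?_
  have hI := Real.sqrt_pos.mpr (hf I)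
  have hJ := Real.sqrt_pos.mpr (hf J)
  field_simp

theorem dotProduct_self_pos {ι : Type*} [Fintype ι] {x : ι → ℝ} (hx : x ≠ 0) : 0 < x ⬝ᵥ x :=
  lt_of_le_of_ne (Finset.sum_nonneg fun _ _ => mul_self_nonneg _)
    fun h => hx (dotProduct_self_eq_zero.mp h.symm)

section Scaling

variable {ι : Type*} [Fintype ι] [DecidableEq ι]

/-- Dividing rows by `f` destroys symmetry; conjugation by `diag √f` restores it without changing
the spectrum. -/
theorem charpoly_symScale (C : Matrix ι ι ℝ) {f : ι → ℝ} (hf : ∀ I, 0 < f I) :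
    (symScale C f).charpoly = (Matrix.of fun I J => C I J / f I).charpoly := by
  have h1 : (Matrix.of fun I J => C I J / f I)
      = (Matrix.diagonal (fun I => (√(f I))⁻¹) * symScale C f)
        * Matrix.diagonal (fun I => √(f I)) := by
    ext I J
    have hI := Real.sqrt_pos.mpr (hf I)
    have hJ := Real.sqrt_pos.mpr (hf J)
    simp only [symScale, Matrix.of_apply, Matrix.mul_diagonal, Matrix.diagonal_mul]
    rw [← Real.mul_self_sqrt (hf I).le]
    field_simp
    rw [Real.sqrt_sq hI.le]
  rw [h1, Matrix.charpoly_mul_comm, ← Matrix.mul_assoc, Matrix.diagonal_mul_diagonal]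
  have h2 : (fun I => √(f I) * (√(f I))⁻¹) = fun _ => (1 : ℝ) :=
    funext fun I => mul_inv_cancel₀ (Real.sqrt_pos.mpr (hf I)).ne'
  rw [h2, Matrix.diagonal_one, Matrix.one_mul]

theorem mul_sum_le_quadForm {C : Matrix ι ι ℝ} (hC : C.IsHermitian) {f : ι → ℝ}
    (hf : ∀ I, 0 < f I) {a : ℝ}
    (ha : ∀ b ∈ (Matrix.of fun I J => C I J / f I).charpoly.roots, a ≤ b) (x : ι → ℝ) :
    a * ∑ I, f I * x I ^ 2 ≤ x ⬝ᵥ C.mulVec x := by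
  rw [← charpoly_symScale C hf] at ha
  have h := mul_dotProduct_self_le (isHermitian_symScale hC f) ha (fun I => √(f I) * x I)
  rw [quadForm_symScale C hf] at h
  have h1 : (fun I => √(f I) * x I / √(f I)) = x :=
    funext fun I => mul_div_cancel_left₀ _ (Real.sqrt_pos.mpr (hf I)).ne'
  rw [h1] at h
  refine le_trans (le_of_eq ?_) h
  congr 1
  simp only [dotProduct]
  refine Finset.sum_congr rfl fun I _ => ?_
  rw [← sq, mul_pow, Real.sq_sqrt (hf I).le]

theorem eigenvalueAt_congr {A B : Matrix ι ι ℝ} (h : A.charpoly = B.charpoly) (i : ℕ) :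
    eigenvalueAt A i = eigenvalueAt B i := by
  rw [eigenvalueAt, eigenvalueAt, sortedEigenvalues, sortedEigenvalues, h]

theorem length_sortedEigenvalues_scale {C : Matrix ι ι ℝ} (hC : C.IsHermitian) {f : ι → ℝ}
    (hf : ∀ I, 0 < f I) :
    (sortedEigenvalues (Matrix.of fun I J => C I J / f I)).length = Fintype.card ι := by
  rw [sortedEigenvalues, ← charpoly_symScale C hf]
  exact length_sortedEigenvalues (isHermitian_symScale hC f)

/-- With `P = diag √f`, the form of `symScale C f` at `P x` is that of `C` at `x`, while `|P x|² ≥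
|x|²`. Nonnegativity of the scaled eigenvalue is what allows this norm comparison to be multiplied
by it. -/
theorem eigenvalueAt_scale_le {C : Matrix ι ι ℝ} (hC : C.IsHermitian) {f : ι → ℝ}
    (hf : ∀ I, 1 ≤ f I)
    (h0 : ∀ b ∈ (Matrix.of fun I J => C I J / f I).charpoly.roots, 0 ≤ b) {i : ℕ}
    (h1 : 1 ≤ i) (h2 : i ≤ Fintype.card ι) :
    eigenvalueAt (Matrix.of fun I J => C I J / f I) i ≤ eigenvalueAt C i := by
  have hf0 : ∀ I, 0 < f I := fun I => zero_lt_one.trans_le (hf I)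
  have hnn := h0 _ (getElem_mem_roots h1 (by rwa [length_sortedEigenvalues_scale hC hf0]))
  rw [← eigenvalueAt_congr (charpoly_symScale C hf0)] at hnn ⊢
  obtain ⟨x, hx0, hx1, hx2⟩ := exists_quadForm_compare hC (isHermitian_symScale hC f)
    (Matrix.diagonal fun I => √(f I)) h1 h2
  have hP : (Matrix.diagonal fun I => √(f I)).mulVec x = fun I => √(f I) * x I :=
    funext fun I => Matrix.mulVec_diagonal _ _ _
  have h3 : (fun I => √(f I) * x I / √(f I)) = x :=
    funext fun I => mul_div_cancel_left₀ _ (Real.sqrt_pos.mpr (hf0 I)).ne'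
  rw [hP, quadForm_symScale C hf0, h3] at hx2
  have hpos : 0 < x ⬝ᵥ x := dotProduct_self_pos hx0
  have hle : x ⬝ᵥ x ≤ (fun I => √(f I) * x I) ⬝ᵥ fun I => √(f I) * x I := by
    refine Finset.sum_le_sum fun I _ => ?_
    rw [← sq, ← sq, mul_pow, Real.sq_sqrt (hf0 I).le]
    exact le_mul_of_one_le_left (sq_nonneg _) (hf I)
  exact le_of_mul_le_mul_right
    (((mul_le_mul_of_nonneg_left hle hnn).trans hx2).trans hx1) hpos

theorem eigenvalueAt_le_mul_scale {C : Matrix ι ι ℝ} (hC : C.IsHermitian) {f : ι → ℝ} {M : ℝ}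
    (hf : ∀ I, 0 < f I) (hM : ∀ I, f I ≤ M)
    (h0 : ∀ b ∈ (Matrix.of fun I J => C I J / f I).charpoly.roots, 0 ≤ b) {i : ℕ}
    (h1 : 1 ≤ i) (h2 : i ≤ Fintype.card ι) :
    eigenvalueAt C i ≤ M * eigenvalueAt (Matrix.of fun I J => C I J / f I) i := by
  have hnn := h0 _ (getElem_mem_roots h1 (by rwa [length_sortedEigenvalues_scale hC hf]))
  rw [← eigenvalueAt_congr (charpoly_symScale C hf)] at hnn ⊢
  obtain ⟨y, hy0, hy1, hy2⟩ := exists_quadForm_compare (isHermitian_symScale hC f) hC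
    (Matrix.diagonal fun I => (√(f I))⁻¹) h1 h2
  have hP : (Matrix.diagonal fun I => (√(f I))⁻¹).mulVec y = fun I => y I / √(f I) :=
    funext fun I => by rw [Matrix.mulVec_diagonal, inv_mul_eq_div]
  rw [quadForm_symScale C hf] at hy1
  rw [hP] at hy2
  set x : ι → ℝ := fun I => y I / √(f I) with hx
  have hx0 : x ≠ 0 := by
    intro h
    refine hy0 (funext fun I => ?_)
    have := congrFun h I
    simpa [hx, (Real.sqrt_pos.mpr (hf I)).ne'] using this
  have hpos : 0 < x ⬝ᵥ x := dotProduct_self_pos hx0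
  have hle : y ⬝ᵥ y ≤ M * (x ⬝ᵥ x) := by
    rw [dotProduct, dotProduct, Finset.mul_sum]
    refine Finset.sum_le_sum fun I _ => ?_
    have hy : y I = √(f I) * x I := by
      rw [hx]; exact (mul_div_cancel₀ _ (Real.sqrt_pos.mpr (hf I)).ne').symm
    rw [hy, ← sq, ← sq, mul_pow, Real.sq_sqrt (hf I).le]
    exact mul_le_mul_of_nonneg_right (hM I) (sq_nonneg _)
  refine le_of_mul_le_mul_right ((hy2.trans hy1).trans ?_) hpos
  calc _ ≤ _ := mul_le_mul_of_nonneg_left hle hnn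
    _ = _ := by ring

/-- Orthogonality separates the first two positions even if their eigenvalues coincide, which later
excludes a double smallest eigenvalue. -/
theorem exists_orthogonal_eigenvectors {A : Matrix ι ι ℝ} (hA : A.IsHermitian)
    (hcard : 2 ≤ Fintype.card ι) : ∃ x y : ι → ℝ, x ≠ 0 ∧ y ≠ 0 ∧ x ⬝ᵥ y = 0 ∧
      A.mulVec x = eigenvalueAt A 1 • x ∧ A.mulVec y = eigenvalueAt A 2 • y := by
  rw [eigenvalueAt_eq_eigenvalues₀ hA le_rfl (by omega),
    eigenvalueAt_eq_eigenvalues₀ hA one_le_two hcard]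
  let e : Fin (Fintype.card ι) ≃ ι := Fintype.equivOfCardEq (Fintype.card_fin _)
  have hj : ∀ j, hA.eigenvalues (e j) = hA.eigenvalues₀ j := fun j => by
    simp [Matrix.IsHermitian.eigenvalues, e]
  have hne : ∀ j, (hA.eigenvectorBasis j).ofLp ≠ 0 := by
    intro j h
    refine hA.eigenvectorBasis.toBasis.ne_zero j ?_
    rw [OrthonormalBasis.coe_toBasis]
    exact (WithLp.ofLp_eq_zero 2).mp h
  refine ⟨_, _, hne (e ⟨Fintype.card ι - 1, by omega⟩), hne (e ⟨Fintype.card ι - 2, by omega⟩),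
    ?_, ?_, ?_⟩
  · have h := hA.eigenvectorBasis.orthonormal.2
      (i := e ⟨Fintype.card ι - 2, by omega⟩) (j := e ⟨Fintype.card ι - 1, by omega⟩)
      (fun h => by
        have := congrArg Fin.val (e.injective h)
        simp at this
        omega)
    beta_reduce at h
    rwa [EuclideanSpace.inner_eq_star_dotProduct, star_trivial] at h
  · rw [hA.mulVec_eigenvectorBasis, hj]
  · rw [hA.mulVec_eigenvectorBasis, hj]

end Scaling

end TensorCov

/-! ### Lower bounds for `η_i`, and the comparison of `C` with `C̃`. -/

namespace TensorCov

theorem etaValue_nonneg {n d i : ℕ} (hi : 2 * i ≤ d) {R : ℝ} (hR : 0 < R) :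
    0 ≤ etaValue n d R i := by
  rw [etaValue]
  split_ifs with h
  · have : 0 ≤ ∏ j ∈ Finset.range (d - i), ((n : ℝ) + 2 * j) :=
      Finset.prod_nonneg fun j _ => by positivity
    positivity
  · have : 0 ≤ ∏ j ∈ Finset.range (d / 2), ((d : ℝ) + n - 2 * j) := by
      refine Finset.prod_nonneg fun j hj => ?_
      have h1 : 2 * j ≤ d := by rw [Finset.mem_range] at hj; omega
      have h2 : (2 : ℝ) * j ≤ d := by exact_mod_cast h1
      have := Nat.cast_nonneg (α := ℝ) n
      linarith
    positivity

theorem two_pow_mul_factorial_mul_prod_le (n d : ℕ) {i : ℕ} (hi : 2 * i ≤ d) :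
    2 ^ i * (i ! : ℝ) * ∏ j ∈ Finset.range (d - i), ((n : ℝ) + 2 * j)
      ≤ ∏ j ∈ Finset.range d, ((n : ℝ) + 2 * j) := by
  induction i with
  | zero => simp
  | succ i ih =>
    refine le_trans ?_ (ih (by omega))
    rw [show d - i = d - (i + 1) + 1 by omega, Finset.prod_range_succ, Nat.factorial_succ]
    have h0 : 0 ≤ ∏ j ∈ Finset.range (d - (i + 1)), ((n : ℝ) + 2 * j) :=
      Finset.prod_nonneg fun j _ => by positivity
    have h1 : ((i : ℝ) + 1) ≤ ((d - (i + 1) : ℕ) : ℝ) := by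
      exact_mod_cast (by omega : i + 1 ≤ d - (i + 1))
    have hn := Nat.cast_nonneg (α := ℝ) n
    have h2 : 2 * ((i : ℝ) + 1) ≤ n + 2 * ((d - (i + 1) : ℕ) : ℝ) := by linarith
    calc _ = (2 ^ i * (i ! : ℝ) * ∏ j ∈ Finset.range (d - (i + 1)), ((n : ℝ) + 2 * j))
          * (2 * ((i : ℝ) + 1)) := by push_cast; ring
      _ ≤ _ := mul_le_mul_of_nonneg_left h2 (by positivity)
      _ = _ := by ring

/-- The constant is `8 = 2² · 2!`, from the case `k = 2`; each later factor `n + 2m + 2k` dominates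
`2(k + 1)`. -/
theorem two_pow_mul_factorial_mul_sq_le (n : ℕ) {m k : ℕ} (hm : 1 ≤ m) (hk : 2 ≤ k) :
    2 ^ k * (k ! : ℝ) * ((n : ℝ) + 2 * m) ^ 2
      ≤ 8 * ∏ j ∈ Finset.range k, ((n : ℝ) + 2 * m + 2 * j) := by
  induction k, hk using Nat.le_induction with
  | base =>
    have : 0 ≤ (n : ℝ) + 2 * m := by positivity
    simp [Finset.prod_range_succ, Nat.factorial]
    nlinarith
  | succ k hk ih =>
    rw [Finset.prod_range_succ, Nat.factorial_succ]
    have h0 : 0 ≤ ∏ j ∈ Finset.range k, ((n : ℝ) + 2 * m + 2 * j) :=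
      Finset.prod_nonneg fun j _ => by positivity
    have hm' : (1 : ℝ) ≤ m := by exact_mod_cast hm
    have hn := Nat.cast_nonneg (α := ℝ) n
    have h2 : 2 * ((k : ℝ) + 1) ≤ n + 2 * m + 2 * k := by linarith
    calc _ = (2 ^ k * (k ! : ℝ) * ((n : ℝ) + 2 * m) ^ 2) * (2 * ((k : ℝ) + 1)) := by
          push_cast; ring
      _ ≤ (8 * ∏ j ∈ Finset.range k, ((n : ℝ) + 2 * m + 2 * j)) * (n + 2 * m + 2 * k) :=
          mul_le_mul ih h2 (by positivity) (by positivity)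
      _ = _ := by ring

theorem ballMomentRatio_eq {n : ℕ} (hn : 1 ≤ n) (d : ℕ) (R : ℝ) :
    ballMomentRatio n d R = R ^ (2 * d) * n
      / ((∏ j ∈ Finset.range d, ((n : ℝ) + 2 * j)) * (n + 2 * d)) := by
  have hn0 : (0 : ℝ) < n := by exact_mod_cast hn
  rw [ballMomentRatio, ← mul_prod_range_add_two_mul_succ, mul_comm (R ^ (2 * d)),
    mul_div_mul_left _ _ hn0.ne']

theorem ballMomentRatio_pos (n d : ℕ) {R : ℝ} (hR : 0 < R) : 0 < ballMomentRatio n d R := by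
  have : 0 < ∏ j ∈ Finset.range d, ((n : ℝ) + 2 * (j + 1)) :=
    Finset.prod_pos fun j _ => by positivity
  rw [ballMomentRatio]
  positivity

/-- For `2i < d` the quotient `η_i / κ_d` is the product of the last `i` factors `n + 2j` over `2^i
i!`, at least `1` because each of them is at least `2i`. For `d = 2i` the mean correction replaces
this by a bound using `8 ≤ d²` and `i ≥ 2`. At `d = 2` the quotient is `2 / (n + 2) < 1`, which is
why that degree behaves differently. -/
theorem ballMomentRatio_le_etaValue {n d i : ℕ} (hn : 1 ≤ n) (hd : 3 ≤ d) (hi : 2 * i ≤ d)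
    {R : ℝ} (hR : 0 < R) : ballMomentRatio n d R ≤ etaValue n d R i := by
  have hn0 : (0 : ℝ) < n := by exact_mod_cast hn
  have hpos : ∀ k, 0 < ∏ j ∈ Finset.range k, ((n : ℝ) + 2 * j) := fun k =>
    Finset.prod_pos fun j _ => by positivity
  rw [ballMomentRatio_eq hn, etaValue]
  split_ifs with h
  · have h1 := two_pow_mul_factorial_mul_prod_le n d hi
    have h2 := hpos (d - i)
    calc _ = R ^ (2 * d) * (n / (n + 2 * d)) *
          (1 / ∏ j ∈ Finset.range d, ((n : ℝ) + 2 * j)) := by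
          have := hpos d
          field_simp
      _ ≤ _ := mul_le_mul_of_nonneg_left
          (one_div_le_one_div_of_le (by positivity) h1) (by positivity)
  · obtain rfl : d = 2 * i := by omega
    have hi2 : 2 ≤ i := by omega
    have h1 := two_pow_mul_factorial_mul_sq_le n (m := i) (k := i) (by omega) hi2
    have hsplit : ∏ j ∈ Finset.range (2 * i), ((n : ℝ) + 2 * j)
        = (∏ j ∈ Finset.range i, ((n : ℝ) + 2 * j))
          * ∏ j ∈ Finset.range i, ((n : ℝ) + 2 * i + 2 * j) := by
      rw [two_mul, Finset.prod_range_add]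
      congr 1
      refine Finset.prod_congr rfl fun j _ => ?_
      push_cast
      ring
    have hA := hpos i
    have hW : 0 < ∏ j ∈ Finset.range i, ((n : ℝ) + 2 * i + 2 * j) :=
      Finset.prod_pos fun j _ => by positivity
    rw [show 2 * i / 2 = i by omega, prod_range_sub_two_mul, prod_range_add_two_mul_succ hn, hsplit]
    generalize (∏ j ∈ Finset.range i, ((n : ℝ) + 2 * j)) = A at *
    generalize (∏ j ∈ Finset.range i, ((n : ℝ) + 2 * i + 2 * j)) = W at *
    have hi2' : (2 : ℝ) ≤ i := by exact_mod_cast hi2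
    have h3 : 2 ^ i * (i ! : ℝ) * ((n : ℝ) + 2 * i) ^ 2 ≤ (2 * i) ^ 2 * W := by
      refine h1.trans (mul_le_mul_of_nonneg_right ?_ hW.le)
      nlinarith
    have hF : 0 < (2 : ℝ) ^ i * (i ! : ℝ) := by positivity
    have e1 : R ^ (2 * (2 * i)) * (n : ℝ) / (A * W * (n + 2 * ((2 * i : ℕ) : ℝ)))
        = R ^ (2 * (2 * i)) * n / (A * (n + 2 * ((2 * i : ℕ) : ℝ))) * (1 / W) := by
      field_simp
    have e2 : R ^ (2 * (2 * i)) * (((2 * i : ℕ) : ℝ) ^ 2 / (2 ^ i * (i ! : ℝ)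
          * (n + 2 * ((2 * i : ℕ) : ℝ)) * (n + ((2 * i : ℕ) : ℝ)) * (A * (n + 2 * i) / n)))
        = R ^ (2 * (2 * i)) * n / (A * (n + 2 * ((2 * i : ℕ) : ℝ)))
          * ((2 * i) ^ 2 / (2 ^ i * (i ! : ℝ) * ((n : ℝ) + 2 * i) ^ 2)) := by
      push_cast
      field_simp
    rw [e1, e2]
    refine mul_le_mul_of_nonneg_left ?_ (by positivity)
    rw [div_le_div_iff₀ hW (by positivity), one_mul]
    exact h3

theorem one_div_factorial_le_ballMomentRatio {n : ℕ} (d : ℕ) {R : ℝ}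
    (hR : R ^ 2 = n + 2) : 1 / ((d + 1)! : ℝ) ≤ ballMomentRatio n d R := by
  have hn := Nat.cast_nonneg (α := ℝ) n
  have hP : 0 < ∏ j ∈ Finset.range d, ((n : ℝ) + 2 * (j + 1)) :=
    Finset.prod_pos fun j _ => by positivity
  have hF : (0 : ℝ) < ((d + 1)! : ℝ) := by positivity
  rw [ballMomentRatio, div_le_div_iff₀ hF hP, one_mul, pow_mul, hR]
  clear hP hF
  induction d with
  | zero => simp
  | succ d ih =>
    rw [Finset.prod_range_succ, Nat.factorial_succ, pow_succ]
    have h : (n : ℝ) + 2 * (d + 1) ≤ (n + 2) * (d + 2) := by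
      have := Nat.cast_nonneg (α := ℝ) d
      nlinarith
    calc _ ≤ ((n : ℝ) + 2) ^ d * ((d + 1)! : ℝ) * ((n + 2) * (d + 2)) :=
          mul_le_mul ih h (by positivity) (by positivity)
      _ = _ := by push_cast; ring

theorem tendsto_ballMomentRatio (d : ℕ) {R : ℕ → ℝ} (hR : ∀ n, 1 ≤ n → R n ^ 2 = n + 2) :
    Tendsto (fun n : ℕ => ballMomentRatio n d (R n)) atTop (𝓝 1) := by
  have h1 : Tendsto (fun n : ℕ => ∏ j ∈ Finset.range d, (((n : ℝ) + 2) / (n + 2 * (j + 1))))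
      atTop (𝓝 (∏ _j ∈ Finset.range d, 1)) := by
    refine tendsto_finsetProd _ fun j _ => ?_
    have h2 : Tendsto (fun n : ℕ => 1 - (2 * (j : ℝ)) / (n + 2 * (j + 1))) atTop (𝓝 (1 - 0)) := by
      refine tendsto_const_nhds.sub (Tendsto.div_atTop tendsto_const_nhds ?_)
      exact tendsto_atTop_add_const_right _ _ tendsto_natCast_atTop_atTop
    rw [sub_zero] at h2
    refine h2.congr fun n => ?_
    have : (n : ℝ) + 2 * (j + 1) ≠ 0 := by positivity
    field_simp
    ring
  rw [Finset.prod_const_one] at h1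
  refine h1.congr' ?_
  filter_upwards [eventually_ge_atTop 1] with n hn
  rw [Finset.prod_div_distrib, Finset.prod_const, Finset.card_range, ballMomentRatio, pow_mul,
    hR n hn]

theorem isHermitian_tensorCov {n : ℕ} (d : ℕ) (μ : Measure (EuclideanSpace ℝ (Fin n))) :
    (tensorCov d μ).IsHermitian := by
  ext I J
  simp only [Matrix.conjTranspose_apply, star_trivial, tensorCov, Matrix.of_apply]
  rw [add_comm, mul_comm]

theorem one_le_multiFactorial {n : ℕ} (I : Fin n →₀ ℕ) : 1 ≤ multiFactorial I := by
  have : ∏ _j : Fin n, (1 : ℝ) ≤ ∏ j, ((I j)! : ℝ) :=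
    Finset.prod_le_prod (fun _ _ => zero_le_one) fun j _ => by
      exact_mod_cast Nat.one_le_iff_ne_zero.mpr (Nat.factorial_ne_zero _)
  simpa [multiFactorial] using this

theorem multiFactorial_le {n d : ℕ} (I : MultiIndex n d) : multiFactorial I.1 ≤ (d ! : ℝ) := by
  have h := Nat.le_of_dvd (Nat.factorial_pos _)
    (Nat.prod_factorial_dvd_factorial_sum Finset.univ fun j => I.1 j)
  rw [← Finsupp.degree_eq_sum, MultiIndex.degree_eq] at h
  rw [multiFactorial]
  exact_mod_cast h

theorem etaValue_le_of_mem_roots {n d : ℕ} (hn : 1 ≤ n) {R : ℝ} (hR : 0 < R) {a b : ℝ}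
    (ha : ∀ i, 2 * i ≤ d → a ≤ etaValue n d R i)
    (hb : b ∈ (tensorCovTilde d (uniformBall n R)).charpoly.roots) : a ≤ b := by
  rw [roots_charpoly_tensorCovTilde hn d hR, Multiset.mem_sum] at hb
  obtain ⟨i, hi, hb⟩ := hb
  rw [Multiset.eq_of_mem_replicate hb]
  exact ha i (by rw [Finset.mem_range] at hi; omega)

theorem eigenvalueAt_comparison {n d : ℕ} (hn : 1 ≤ n) {R : ℝ} (hR : 0 < R) :
    (sortedEigenvalues (tensorCov d (uniformBall n R))).length = (d + n - 1).choose d ∧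
    (sortedEigenvalues (tensorCovTilde d (uniformBall n R))).length = (d + n - 1).choose d ∧
    (sortedEigenvalues (tensorCovTilde d (uniformBall n R)) : Multiset ℝ)
      = ∑ i ∈ Finset.range (d / 2 + 1),
          Multiset.replicate (harmonicDim n (d - 2 * i)) (etaValue n d R i) ∧
    ∀ i, 1 ≤ i → i ≤ (d + n - 1).choose d →
      eigenvalueAt (tensorCovTilde d (uniformBall n R)) i
          ≤ eigenvalueAt (tensorCov d (uniformBall n R)) i ∧
      eigenvalueAt (tensorCov d (uniformBall n R)) i
          ≤ (d ! : ℝ) * eigenvalueAt (tensorCovTilde d (uniformBall n R)) i := by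
  have hC := isHermitian_tensorCov d (uniformBall n R)
  have hcard : Fintype.card (MultiIndex n d) = (d + n - 1).choose d := by
    rw [card_multiIndex, add_comm]
  have h0 : ∀ b ∈ (tensorCovTilde d (uniformBall n R)).charpoly.roots, 0 ≤ b := fun b hb =>
    etaValue_le_of_mem_roots hn hR (fun i hi => etaValue_nonneg hi hR) hb
  rw [← hcard]
  refine ⟨length_sortedEigenvalues hC,
    length_sortedEigenvalues_scale hC fun I => multiFactorial_pos I.1, ?_, fun i h1 h2 =>
    ⟨eigenvalueAt_scale_le hC (fun I => one_le_multiFactorial I.1) h0 h1 h2,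
    eigenvalueAt_le_mul_scale hC (fun I => multiFactorial_pos I.1) multiFactorial_le h0 h1 h2⟩⟩
  rw [← roots_charpoly_tensorCovTilde hn d hR]
  exact Multiset.sort_eq _ _

end TensorCov

namespace TensorCov

open MvPolynomial

/-! ### Degree at least three: squarefree monomials. -/

section Squarefree

theorem gaussMoment_add_self {k : ℕ} (hk : k ≤ 1) : gaussMoment (k + k) = 1 := by
  interval_cases k <;> simp [gaussMoment]

theorem tensorCov_apply_of_moment_eq_zero {n d : ℕ} (hn : 1 ≤ n) {R : ℝ} (hR : 0 < R)
    (I J : MultiIndex n d) (hJ : gaussMixedMoment J.1 = 0) :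
    tensorCov d (uniformBall n R) I J
      = ballMomentRatio n d R * gaussMixedMoment (I.1 + J.1) := by
  rcases Nat.even_or_odd d with ⟨m, hm⟩ | hd
  · rw [← two_mul] at hm
    subst hm
    rw [tensorCov_apply_of_even hn hR, hJ, mul_zero, mul_zero, sub_zero]
  · exact tensorCov_apply_of_odd hn hd hR I J

/-- A nonzero moment forces `I` and `J` to agree modulo `2`. As `J` has entries at most `1`, this
gives `J ≤ I`, and equal degrees give `I = J`. -/
theorem gaussMixedMoment_add_of_squarefree {n d : ℕ} (I J : MultiIndex n d)
    (hJ : ∀ j, J.1 j ≤ 1) : gaussMixedMoment (I.1 + J.1) = if I = J then 1 else 0 := by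
  split_ifs with h
  · subst h
    exact Finset.prod_eq_one fun j _ => gaussMoment_add_self (hJ j)
  · by_contra h0
    have hev : ∀ j, Even (I.1 j + J.1 j) := fun j => by
      by_contra hj
      exact h0 (gaussMixedMoment_eq_zero (i := j) (Nat.not_even_iff_odd.mp hj))
    have hle : ∀ j ∈ Finset.univ, J.1 j ≤ I.1 j := fun j _ => by
      have := hJ j
      obtain ⟨r, hr⟩ := hev j
      omega
    have hs : ∑ j, J.1 j = ∑ j, I.1 j := by
      rw [← Finsupp.degree_eq_sum, ← Finsupp.degree_eq_sum, MultiIndex.degree_eq,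
        MultiIndex.degree_eq]
    refine h (Subtype.ext (Finsupp.ext fun j => ?_))
    exact ((Finset.sum_eq_sum_iff_of_le hle).mp hs j (Finset.mem_univ j)).symm

theorem gaussMixedMoment_of_squarefree {n d : ℕ} (hd : 1 ≤ d) (J : MultiIndex n d)
    (hJ : ∀ j, J.1 j ≤ 1) : gaussMixedMoment J.1 = 0 := by
  have hJ0 : J.1 ≠ 0 := by
    intro h
    have := MultiIndex.degree_eq J
    rw [h, map_zero] at this
    omega
  obtain ⟨j, hj⟩ := Finsupp.ne_iff.mp hJ0
  have h1 : J.1 j = 1 := le_antisymm (hJ j) (Nat.one_le_iff_ne_zero.mpr hj)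
  exact gaussMixedMoment_eq_zero (i := j) (by rw [h1]; exact odd_one)

theorem tensorCov_mulVec_single {n d : ℕ} (hn : 1 ≤ n) (hd : 1 ≤ d) {R : ℝ} (hR : 0 < R)
    (J : MultiIndex n d) (hJ : ∀ j, J.1 j ≤ 1) :
    (tensorCov d (uniformBall n R)).mulVec (Pi.single J 1)
      = ballMomentRatio n d R • Pi.single J 1 := by
  ext I
  rw [Matrix.mulVec_single_one, Matrix.col_apply,
    tensorCov_apply_of_moment_eq_zero hn hR I J (gaussMixedMoment_of_squarefree hd J hJ),
    gaussMixedMoment_add_of_squarefree I J hJ, Pi.smul_apply, Pi.single_apply, smul_eq_mul]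

theorem one_lt_multiFactorial {n : ℕ} {J : Fin n →₀ ℕ} (hJ : ¬ ∀ j, J j ≤ 1) :
    1 < multiFactorial J := by
  push Not at hJ
  obtain ⟨j, hj⟩ := hJ
  have h1 : (1 : ℝ) < ((J j)! : ℝ) := by exact_mod_cast Nat.one_lt_factorial.mpr hj
  refine h1.trans_le ?_
  rw [multiFactorial, ← Finset.mul_prod_erase _ _ (Finset.mem_univ j)]
  refine le_mul_of_one_le_right (by positivity) ?_
  exact_mod_cast Nat.one_le_iff_ne_zero.mpr
    (Finset.prod_ne_zero_iff.mpr fun i _ => Nat.factorial_ne_zero _)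

/-- The squarefree multi-index with support `S`. -/
noncomputable def indicatorIndex {n : ℕ} (S : Finset (Fin n)) : MultiIndex n S.card :=
  ⟨∑ j ∈ S, Finsupp.single j 1, mem_multiIndex.mpr (by simp)⟩

theorem indicatorIndex_apply {n : ℕ} (S : Finset (Fin n)) (j : Fin n) :
    (indicatorIndex S).1 j = if j ∈ S then 1 else 0 := by
  simp [indicatorIndex, Finsupp.finsetSum_apply, Finsupp.single_apply]

theorem indicatorIndex_le_one {n : ℕ} (S : Finset (Fin n)) (j : Fin n) :
    (indicatorIndex S).1 j ≤ 1 := by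
  rw [indicatorIndex_apply]; split_ifs <;> simp

theorem coeffVec_prod_X {n : ℕ} (S : Finset (Fin n)) :
    coeffVec S.card (∏ j ∈ S, X j) = Pi.single (indicatorIndex S) 1 := by
  classical
  have h : ∏ j ∈ S, (X j : MvPolynomial (Fin n) ℝ) = monomial (∑ j ∈ S, Finsupp.single j 1) 1 := by
    rw [monomial_sum_one]
    rfl
  ext I
  rw [coeffVec, h, coeff_monomial, Pi.single_apply]
  refine if_congr ?_ rfl rfl
  rw [Subtype.ext_iff]
  exact eq_comm

theorem exists_eq_indicatorIndex {n d : ℕ} (I : MultiIndex n d) (hI : ∀ j, I.1 j ≤ 1) :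
    ∃ S : Finset (Fin n), S.card = d ∧ I.1 = (indicatorIndex S).1 := by
  have h : I.1 = (indicatorIndex I.1.support).1 := by
    ext j
    have := hI j
    rw [indicatorIndex_apply]
    split_ifs with h <;> rw [Finsupp.mem_support_iff] at h <;> omega
  refine ⟨I.1.support, ?_, h⟩
  rw [← MultiIndex.degree_eq (indicatorIndex I.1.support), ← h, MultiIndex.degree_eq]

variable {n d : ℕ} {R : ℝ}

theorem ballMomentRatio_mul_le_quadForm (hn : 1 ≤ n) (hd : 3 ≤ d) (hR : 0 < R)
    (x : MultiIndex n d → ℝ) : ballMomentRatio n d R * ∑ I, multiFactorial I.1 * x I ^ 2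
      ≤ x ⬝ᵥ (tensorCov d (uniformBall n R)).mulVec x :=
  mul_sum_le_quadForm (isHermitian_tensorCov d _) (fun I => multiFactorial_pos I.1)
    (fun _ hb => etaValue_le_of_mem_roots hn hR
      (fun _ hi => ballMomentRatio_le_etaValue hn hd hi hR) hb) x

theorem ballMomentRatio_le_eigenvalueAt_tilde (hn : 1 ≤ n) (hd : 3 ≤ d) (hR : 0 < R) {i : ℕ}
    (h1 : 1 ≤ i) (h2 : i ≤ (d + n - 1).choose d) :
    ballMomentRatio n d R ≤ eigenvalueAt (tensorCovTilde d (uniformBall n R)) i := by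
  refine etaValue_le_of_mem_roots hn hR (fun _ hi => ballMomentRatio_le_etaValue hn hd hi hR)
    (getElem_mem_roots h1 ?_)
  rwa [(eigenvalueAt_comparison hn hR).2.1]

theorem ballMomentRatio_le_eigenvalueAt (hn : 1 ≤ n) (hd : 3 ≤ d) (hR : 0 < R) {i : ℕ}
    (h1 : 1 ≤ i) (h2 : i ≤ (d + n - 1).choose d) :
    ballMomentRatio n d R ≤ eigenvalueAt (tensorCov d (uniformBall n R)) i :=
  (ballMomentRatio_le_eigenvalueAt_tilde hn hd hR h1 h2).trans
    ((eigenvalueAt_comparison hn hR).2.2.2 i h1 h2).1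

theorem exists_squarefree (hdn : d ≤ n) : ∃ J : MultiIndex n d, ∀ j, J.1 j ≤ 1 := by
  obtain ⟨S, -, rfl⟩ := Finset.exists_subset_card_eq
    (s := (Finset.univ : Finset (Fin n))) (n := d) (by simpa using hdn)
  exact ⟨indicatorIndex S, indicatorIndex_le_one S⟩

theorem eigenvalueAt_one_tensorCov (hd : 3 ≤ d) (hdn : d ≤ n) (hR : 0 < R) :
    eigenvalueAt (tensorCov d (uniformBall n R)) 1 = ballMomentRatio n d R := by
  obtain ⟨J, hJ⟩ := exists_squarefree hdn
  refine le_antisymm (eigenvalueAt_one_le ?_) (ballMomentRatio_le_eigenvalueAt (by omega) hd hR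
    le_rfl (Nat.choose_pos (by omega)))
  refine mem_roots_charpoly_iff.mpr ⟨Pi.single J 1, ?_,
    tensorCov_mulVec_single (by omega) (by omega) hR J hJ⟩
  simp

theorem eigenvalueAt_one_tensorCovTilde (hd : 3 ≤ d) (hdn : d ≤ n) (hR : 0 < R) :
    eigenvalueAt (tensorCovTilde d (uniformBall n R)) 1 = ballMomentRatio n d R := by
  refine le_antisymm ?_ (ballMomentRatio_le_eigenvalueAt_tilde (by omega) hd hR
    le_rfl (Nat.choose_pos (by omega)))
  rw [← eigenvalueAt_one_tensorCov hd hdn hR]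
  exact ((eigenvalueAt_comparison (by omega) hR).2.2.2 1 le_rfl (Nat.choose_pos (by omega))).1

theorem eigenspace_tensorCov (hd : 3 ≤ d) (hdn : d ≤ n) (hR : 0 < R) :
    Module.End.eigenspace (Matrix.toLin' (tensorCov d (uniformBall n R)))
        (eigenvalueAt (tensorCov d (uniformBall n R)) 1)
      = Submodule.span ℝ {v | ∃ S : Finset (Fin n), S.card = d ∧
          v = coeffVec d (∏ j ∈ S, X j)} := by
  rw [eigenvalueAt_one_tensorCov hd hdn hR]
  apply le_antisymm
  · intro x hx
    rw [Module.End.mem_eigenspace_iff, Matrix.toLin'_apply] at hx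
    have h1 := ballMomentRatio_mul_le_quadForm (by omega : 1 ≤ n) hd hR x
    rw [hx, dotProduct_smul, smul_eq_mul] at h1
    have h2 := le_of_mul_le_mul_left h1 (ballMomentRatio_pos n d hR)
    have h3 : ∀ I ∈ Finset.univ, x I * x I ≤ multiFactorial I.1 * x I ^ 2 := fun I _ => by
      rw [← sq]
      exact le_mul_of_one_le_left (sq_nonneg _) (one_le_multiFactorial _)
    -- For an eigenvector the two sums coincide, hence so do all their terms: `x I ^ 2 = I! * x I ^
    -- 2`, and `x I = 0` whenever `I! > 1`.
    have h4 := (Finset.sum_eq_sum_iff_of_le h3).mp (le_antisymm (Finset.sum_le_sum h3) h2)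
    have h5 : x = ∑ I, x I • (Pi.single I (1 : ℝ) : MultiIndex n d → ℝ) := pi_eq_sum_univ' x
    rw [h5]
    refine Submodule.sum_mem _ fun I _ => ?_
    by_cases hI : ∀ j, I.1 j ≤ 1
    · refine Submodule.smul_mem _ _ (Submodule.subset_span ?_)
      obtain ⟨S, rfl, hS⟩ := exists_eq_indicatorIndex I hI
      exact ⟨S, rfl, by rw [coeffVec_prod_X, Subtype.ext hS]⟩
    · have h6 := h4 I (Finset.mem_univ _)
      have h7 := one_lt_multiFactorial hI
      have h8 : x I = 0 := by
        by_contra h0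
        have : 0 < x I ^ 2 := by positivity
        nlinarith
      rw [h8, zero_smul]
      exact Submodule.zero_mem _
  · rw [Submodule.span_le]
    rintro _ ⟨S, rfl, rfl⟩
    rw [SetLike.mem_coe, Module.End.mem_eigenspace_iff, Matrix.toLin'_apply, coeffVec_prod_X]
    exact tensorCov_mulVec_single (by omega) (by omega) hR _ (indicatorIndex_le_one S)

end Squarefree

/-! ### Degree two: a rank-one perturbation of a diagonal matrix. -/

section DegreeTwo

variable {n : ℕ}

theorem multiIndex_two_cases (I : MultiIndex n 2) :
    (∃ j, I.1 = Finsupp.single j 2) ∨ ((∀ j, I.1 j ≤ 1) ∧ ∃ j, I.1 j = 1) := by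
  have hdeg := MultiIndex.degree_eq I
  by_cases h : ∀ j, I.1 j ≤ 1
  · right
    refine ⟨h, ?_⟩
    have hI0 : I.1 ≠ 0 := by
      intro h0
      rw [h0, map_zero] at hdeg
      omega
    obtain ⟨j, hj⟩ := Finsupp.ne_iff.mp hI0
    exact ⟨j, le_antisymm (h j) (Nat.one_le_iff_ne_zero.mpr hj)⟩
  · left
    push Not at h
    obtain ⟨j, hj⟩ := h
    refine ⟨j, ?_⟩
    have hle : Finsupp.single j 2 ≤ I.1 := Finsupp.single_le_iff.mpr hj
    obtain ⟨K, hK⟩ := exists_add_of_le hle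
    rw [hK, map_add, Finsupp.degree_single] at hdeg
    have : K = 0 := (Finsupp.degree_eq_zero_iff _).mp (by omega)
    rw [hK, this, add_zero]

theorem multiFactorial_single_two (j : Fin n) : multiFactorial (Finsupp.single j 2) = 2 := by
  rw [multiFactorial, Finset.prod_eq_single j]
  · simp
  · intro i _ hi
    simp [hi.symm]
  · simp

/-- The vector of the moments of degree two, i.e. the coefficients of `∑ X_j ^ 2`. -/
noncomputable def momentVec (n : ℕ) : MultiIndex n 2 → ℝ := fun I => gaussMixedMoment I.1

theorem coeffVec_sum_sq : coeffVec 2 (∑ j : Fin n, X j ^ 2) = momentVec n := by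
  classical
  ext I
  rw [coeffVec, momentVec, coeff_sum]
  simp only [X_pow_eq_monomial, coeff_monomial]
  rcases multiIndex_two_cases I with ⟨j, hj⟩ | ⟨h, j, hj⟩
  · rw [hj, gaussMixedMoment_single_two, Finset.sum_eq_single_of_mem j (Finset.mem_univ _)]
    · simp
    · intro i _ hi
      rw [if_neg]
      intro h
      exact hi (Finsupp.single_left_injective two_ne_zero h)
  · rw [gaussMixedMoment_eq_zero (i := j) (by rw [hj]; exact odd_one), Finset.sum_eq_zero]
    intro i _
    rw [if_neg]
    intro h'
    have := h i
    rw [← h', Finsupp.single_eq_same] at this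
    omega

theorem multiFactorial_mul_momentVec (I : MultiIndex n 2) :
    multiFactorial I.1 * momentVec n I = 2 * momentVec n I := by
  rcases multiIndex_two_cases I with ⟨j, hj⟩ | ⟨-, j, hj⟩
  · rw [hj, multiFactorial_single_two]
  · rw [momentVec, gaussMixedMoment_eq_zero (i := j) (by rw [hj]; exact odd_one), mul_zero,
      mul_zero]

theorem momentVec_dotProduct_self : momentVec n ⬝ᵥ momentVec n = n := by
  classical
  have h : ∀ I, momentVec n I * momentVec n I
      = ∑ j : Fin n, if Finsupp.single j 2 = I.1 then 1 else 0 := by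
    intro I
    have h1 : momentVec n I * momentVec n I = momentVec n I := by
      rcases multiIndex_two_cases I with ⟨j, hj⟩ | ⟨-, j, hj⟩
      · rw [momentVec, hj, gaussMixedMoment_single_two, mul_one]
      · rw [momentVec, gaussMixedMoment_eq_zero (i := j) (by rw [hj]; exact odd_one), mul_zero]
    rw [h1, ← coeffVec_sum_sq, coeffVec, coeff_sum]
    simp only [X_pow_eq_monomial, coeff_monomial]
  simp only [dotProduct, h]
  rw [Finset.sum_comm]
  have h2 : ∀ j : Fin n, ∑ I : MultiIndex n 2,
      (if Finsupp.single j 2 = I.1 then (1 : ℝ) else 0) = 1 := by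
    intro j
    rw [Finset.sum_eq_single_of_mem
      (⟨Finsupp.single j 2, mem_multiIndex.mpr (by simp)⟩ : MultiIndex n 2) (Finset.mem_univ _)]
    · simp
    · intro I _ hI
      rw [if_neg]
      intro h
      exact hI (Subtype.ext h.symm)
  rw [Finset.sum_congr rfl fun j _ => h2 j]
  simp

/-- In degree two only `k = 0, 1` survive in Wick's formula: the first gives the diagonal of the
`I!`, the second the product of the means. -/
theorem gaussMixedMoment_add_two (I J : MultiIndex n 2) :
    gaussMixedMoment (I.1 + J.1)
      = (if I = J then multiFactorial I.1 else 0) + momentVec n I * momentVec n J := by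
  classical
  have h1 := gaussMixedMoment_mul (m := 1) I J
  have h2 := gaussMixedMoment_add (N := 3) (by omega) I J
  rw [radialOp_apply, Finset.sum_range_succ, Finset.sum_range_succ, Finset.sum_range_one,
    lap_pow_eq_zero 2 (isHomogeneous_multiIndex J) (by omega), mul_zero, smul_zero, add_zero,
    coeff_add, mul_add, ← h1] at h2
  rw [h2, momentVec, momentVec]
  congr 1
  simp only [heatCoeff, pow_zero, Nat.factorial_zero, Nat.cast_one, mul_one, inv_one, one_pow,
    one_smul, Module.End.one_apply, one_mul, coeff_monomial, mul_ite, mul_zero]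
  simp only [← Subtype.ext_iff, eq_comm (a := J)]

variable {R : ℝ}

/-- Here `κ_1 = 1` and `κ_2 = (n + 2)/(n + 4)`, so the coefficient of the rank-one part is `κ_2 - 1
= -2/(n + 4)`. -/
theorem tensorCov_two_mulVec (hn : 1 ≤ n) (hR : 0 < R) (hR2 : R ^ 2 = n + 2)
    (x : MultiIndex n 2 → ℝ) (I : MultiIndex n 2) :
    (tensorCov 2 (uniformBall n R)).mulVec x I
      = ((n : ℝ) + 2) / (n + 4) * (multiFactorial I.1 * x I)
        - 2 / (n + 4) * (momentVec n ⬝ᵥ x) * momentVec n I := by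
  have h1 : ballMomentRatio n (2 * 1) R = ((n : ℝ) + 2) / (n + 4) := by
    rw [ballMomentRatio, pow_mul, hR2]
    simp only [mul_one, Finset.prod_range_succ, Finset.prod_range_zero]
    push_cast
    have : (n : ℝ) + 4 ≠ 0 := by positivity
    have : (n : ℝ) + 2 ≠ 0 := by positivity
    field_simp
    ring
  have h2 : ballMomentRatio n 1 R = 1 := by
    rw [ballMomentRatio, pow_mul, hR2]
    simp only [Finset.prod_range_one]
    push_cast
    have : (n : ℝ) + 2 ≠ 0 := by positivity
    field_simp
    ring
  have h3 : ∀ J, tensorCov 2 (uniformBall n R) I J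
      = (if I = J then ((n : ℝ) + 2) / (n + 4) * multiFactorial I.1 else 0)
        - 2 / (n + 4) * momentVec n I * momentVec n J := by
    intro J
    have := tensorCov_apply_of_even (m := 1) hn hR I J
    rw [h1, h2, gaussMixedMoment_add_two] at this
    refine this.trans ?_
    have : (n : ℝ) + 4 ≠ 0 := by positivity
    simp only [momentVec]
    split_ifs <;> field_simp <;> ring
  simp only [Matrix.mulVec, dotProduct, h3, sub_mul, ite_mul, zero_mul, Finset.sum_sub_distrib,
    Finset.sum_ite_eq, Finset.mem_univ, if_true, Finset.mul_sum, Finset.sum_mul]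
  congr 1
  · ring
  · exact Finset.sum_congr rfl fun J _ => by ring

theorem tensorCov_two_mulVec_momentVec (hn : 1 ≤ n) (hR : 0 < R) (hR2 : R ^ 2 = n + 2) :
    (tensorCov 2 (uniformBall n R)).mulVec (momentVec n) = (4 / ((n : ℝ) + 4)) • momentVec n := by
  ext I
  rw [tensorCov_two_mulVec hn hR hR2, multiFactorial_mul_momentVec, momentVec_dotProduct_self,
    Pi.smul_apply, smul_eq_mul]
  ring

theorem le_quadForm_of_orthogonal (hn : 3 ≤ n) (hR : 0 < R) (hR2 : R ^ 2 = n + 2)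
    {x : MultiIndex n 2 → ℝ} (hx : momentVec n ⬝ᵥ x = 0) :
    5 / 7 * (x ⬝ᵥ x) ≤ x ⬝ᵥ (tensorCov 2 (uniformBall n R)).mulVec x := by
  have hn' : (3 : ℝ) ≤ n := by exact_mod_cast hn
  have h57 : (5 : ℝ) / 7 ≤ (n + 2) / (n + 4) := by
    rw [div_le_div_iff₀ (by norm_num) (by positivity)]
    linarith
  rw [dotProduct, dotProduct, Finset.mul_sum]
  refine Finset.sum_le_sum fun I _ => ?_
  rw [tensorCov_two_mulVec (by omega) hR hR2, hx, mul_zero, zero_mul, sub_zero]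
  have h1 := one_le_multiFactorial I.1
  calc 5 / 7 * (x I * x I) ≤ (((n : ℝ) + 2) / (n + 4)) * (multiFactorial I.1 * (x I * x I)) :=
        mul_le_mul h57 (le_mul_of_one_le_left (mul_self_nonneg _) h1) (mul_self_nonneg _)
          (by positivity)
    _ = _ := by ring

theorem four_div_lt (hn : 3 ≤ n) : 4 / ((n : ℝ) + 4) < 5 / 7 := by
  have hn' : (3 : ℝ) ≤ n := by exact_mod_cast hn
  rw [div_lt_div_iff₀ (by positivity) (by norm_num)]
  linarith

theorem le_of_eigenvector_of_orthogonal (hn : 3 ≤ n) (hR : 0 < R) (hR2 : R ^ 2 = n + 2)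
    {x : MultiIndex n 2 → ℝ} (hx0 : x ≠ 0) (hx : momentVec n ⬝ᵥ x = 0) {a : ℝ}
    (ha : (tensorCov 2 (uniformBall n R)).mulVec x = a • x) : 5 / 7 ≤ a := by
  have h := le_quadForm_of_orthogonal hn hR hR2 hx
  rw [ha, dotProduct_smul, smul_eq_mul] at h
  exact le_of_mul_le_mul_right h (dotProduct_self_pos hx0)

theorem eigenvalue_tensorCov_two (hn : 3 ≤ n) (hR : 0 < R) (hR2 : R ^ 2 = n + 2)
    {x : MultiIndex n 2 → ℝ} (hx0 : x ≠ 0) {a : ℝ}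
    (ha : (tensorCov 2 (uniformBall n R)).mulVec x = a • x) :
    a = 4 / ((n : ℝ) + 4) ∨ 5 / 7 ≤ a := by
  by_cases hx : momentVec n ⬝ᵥ x = 0
  · exact Or.inr (le_of_eigenvector_of_orthogonal hn hR hR2 hx0 hx ha)
  · left
    have hT : (tensorCov 2 (uniformBall n R)).transpose = tensorCov 2 (uniformBall n R) := by
      rw [← Matrix.conjTranspose_eq_transpose_of_trivial, (isHermitian_tensorCov 2 _).eq]
    have h : momentVec n ⬝ᵥ (tensorCov 2 (uniformBall n R)).mulVec x
        = 4 / ((n : ℝ) + 4) * (momentVec n ⬝ᵥ x) := by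
      rw [Matrix.dotProduct_mulVec, ← Matrix.mulVec_transpose, hT,
        tensorCov_two_mulVec_momentVec (by omega) hR hR2, smul_dotProduct, smul_eq_mul]
    rw [ha, dotProduct_smul, smul_eq_mul] at h
    exact mul_right_cancel₀ hx h

/-- Removing the projection onto `momentVec n`, whose squared norm is `n`, leaves a vector of the
same eigenspace orthogonal to it. If nonzero, it would force `5/7 ≤ 4/(n + 4)`. -/
theorem exists_eq_smul_momentVec (hn : 3 ≤ n) (hR : 0 < R) (hR2 : R ^ 2 = n + 2)
    {x : MultiIndex n 2 → ℝ}
    (hx : (tensorCov 2 (uniformBall n R)).mulVec x = (4 / ((n : ℝ) + 4)) • x) :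
    ∃ t : ℝ, x = t • momentVec n := by
  have hn0 : (n : ℝ) ≠ 0 := by exact_mod_cast (by omega : n ≠ 0)
  refine ⟨(momentVec n ⬝ᵥ x) / n, ?_⟩
  by_contra hne
  refine absurd (le_of_eigenvector_of_orthogonal hn hR hR2 (sub_ne_zero.mpr hne) ?_ ?_)
    (not_le_of_gt (four_div_lt hn))
  · rw [dotProduct_sub, dotProduct_smul, momentVec_dotProduct_self, smul_eq_mul,
      div_mul_cancel₀ _ hn0, sub_self]
  · rw [Matrix.mulVec_sub, Matrix.mulVec_smul, hx,
      tensorCov_two_mulVec_momentVec (by omega) hR hR2, smul_sub, smul_comm]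

theorem momentVec_ne_zero (hn : 1 ≤ n) : momentVec n ≠ 0 := by
  intro h
  have h1 := momentVec_dotProduct_self (n := n)
  rw [h, dotProduct_zero] at h1
  have : n = 0 := by exact_mod_cast h1.symm
  omega

theorem eigenvalueAt_one_tensorCov_two (hn : 3 ≤ n) (hR : 0 < R) (hR2 : R ^ 2 = n + 2) :
    eigenvalueAt (tensorCov 2 (uniformBall n R)) 1 = 4 / ((n : ℝ) + 4) := by
  have hmem : 4 / ((n : ℝ) + 4) ∈ (tensorCov 2 (uniformBall n R)).charpoly.roots :=
    mem_roots_charpoly_iff.mpr ⟨_, momentVec_ne_zero (by omega),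
      tensorCov_two_mulVec_momentVec (by omega) hR hR2⟩
  have hle := eigenvalueAt_one_le hmem
  have hmem1 := getElem_mem_roots (A := tensorCov 2 (uniformBall n R)) (i := 1) le_rfl (by
    rw [(eigenvalueAt_comparison (by omega) hR).1]
    exact Nat.choose_pos (by omega))
  obtain ⟨x, hx0, hx⟩ := mem_roots_charpoly_iff.mp hmem1
  rcases eigenvalue_tensorCov_two hn hR hR2 hx0 hx with h | h
  · exact h
  · exact absurd (h.trans hle) (not_le_of_gt (four_div_lt hn))

theorem le_eigenvalueAt_tensorCov_two (hn : 3 ≤ n) (hR : 0 < R) (hR2 : R ^ 2 = n + 2) {i : ℕ}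
    (h1 : 2 ≤ i) (h2 : i ≤ (2 + n - 1).choose 2) :
    5 / 7 ≤ eigenvalueAt (tensorCov 2 (uniformBall n R)) i := by
  have hl := (eigenvalueAt_comparison (n := n) (d := 2) (by omega) hR).1
  refine le_trans ?_ (eigenvalueAt_mono (i := 2) (by omega) h1 (by rwa [hl]))
  have hC := isHermitian_tensorCov 2 (uniformBall n R)
  obtain ⟨x, y, hx0, hy0, hxy, hx, hy⟩ := exists_orthogonal_eigenvectors hC (by
    rw [← length_sortedEigenvalues hC, hl]; omega)
  -- If the second eigenvalue were also `4/(n + 4)`, the two orthogonal eigenvectors would both be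
  -- nonzero multiples of `momentVec n`.
  rcases eigenvalue_tensorCov_two hn hR hR2 hy0 hy with h | h
  · rw [eigenvalueAt_one_tensorCov_two hn hR hR2] at hx
    rw [h] at hy
    obtain ⟨s, rfl⟩ := exists_eq_smul_momentVec hn hR hR2 hx
    obtain ⟨t, rfl⟩ := exists_eq_smul_momentVec hn hR hR2 hy
    have hs : s ≠ 0 := fun h => hx0 (by rw [h, zero_smul])
    have ht : t ≠ 0 := fun h => hy0 (by rw [h, zero_smul])
    rw [smul_dotProduct, dotProduct_smul, smul_eq_mul, smul_eq_mul] at hxy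
    exact absurd hxy (mul_ne_zero hs (mul_ne_zero ht
      (dotProduct_self_pos (momentVec_ne_zero (by omega))).ne'))
  · exact h

theorem eigenspace_tensorCov_two (hn : 3 ≤ n) (hR : 0 < R) (hR2 : R ^ 2 = n + 2) :
    Module.End.eigenspace (Matrix.toLin' (tensorCov 2 (uniformBall n R)))
        (eigenvalueAt (tensorCov 2 (uniformBall n R)) 1)
      = Submodule.span ℝ {coeffVec 2 (∑ j : Fin n, X j ^ 2)} := by
  rw [eigenvalueAt_one_tensorCov_two hn hR hR2, coeffVec_sum_sq]
  ext x
  rw [Module.End.mem_eigenspace_iff, Matrix.toLin'_apply, Submodule.mem_span_singleton]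
  constructor
  · intro hx
    obtain ⟨t, ht⟩ := exists_eq_smul_momentVec hn hR hR2 hx
    exact ⟨t, ht.symm⟩
  · rintro ⟨t, rfl⟩
    rw [Matrix.mulVec_smul, tensorCov_two_mulVec_momentVec (by omega) hR hR2, smul_comm]

theorem isBigO_eigenvalueAt_tensorCov_two {R : ℕ → ℝ} (hR : ∀ n, 1 ≤ n → 0 < R n)
    (hR2 : ∀ n, 1 ≤ n → R n ^ 2 = n + 2) :
    (fun n : ℕ => eigenvalueAt (tensorCov 2 (uniformBall n (R n))) 1)
      =O[atTop] fun n : ℕ => ((n : ℝ))⁻¹ := by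
  refine IsBigO.of_bound 4 ?_
  filter_upwards [eventually_ge_atTop 3] with n hn
  have hn0 : (0 : ℝ) < n := by exact_mod_cast (by omega : 0 < n)
  rw [eigenvalueAt_one_tensorCov_two hn (hR n (by omega)) (hR2 n (by omega)),
    Real.norm_of_nonneg (by positivity), Real.norm_of_nonneg (by positivity), div_eq_mul_inv]
  refine mul_le_mul_of_nonneg_left (inv_anti₀ hn0 (by linarith)) (by norm_num)

end DegreeTwo

end TensorCov

theorem mainTheorem6
    (d : ℕ) (R : ℕ → ℝ) (hR : ∀ n, 1 ≤ n → IsIsotropicRadius n (R n)) :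
    -- both matrices have `N = binom(d+n-1, d)` real eigenvalues, and
    -- `λ_i(C̃) ≤ λ_i(C) ≤ d! λ_i(C̃)`, the spectrum of `C̃` being explicit
    (∀ n, 1 ≤ n →
      (sortedEigenvalues (tensorCov d (uniformBall n (R n)))).length = (d + n - 1).choose d ∧
      (sortedEigenvalues (tensorCovTilde d (uniformBall n (R n)))).length
        = (d + n - 1).choose d ∧
      (sortedEigenvalues (tensorCovTilde d (uniformBall n (R n))) : Multiset ℝ)
        = ∑ i ∈ Finset.range (d / 2 + 1),
            Multiset.replicate (harmonicDim n (d - 2 * i)) (etaValue n d (R n) i) ∧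
      ∀ i, 1 ≤ i → i ≤ (d + n - 1).choose d →
        eigenvalueAt (tensorCovTilde d (uniformBall n (R n))) i
            ≤ eigenvalueAt (tensorCov d (uniformBall n (R n))) i ∧
        eigenvalueAt (tensorCov d (uniformBall n (R n))) i
            ≤ (d ! : ℝ) * eigenvalueAt (tensorCovTilde d (uniformBall n (R n))) i) ∧
    -- the case `d = 2`
    (d = 2 →
      (∀ n, 3 ≤ n →
        eigenvalueAt (tensorCov d (uniformBall n (R n))) 1 = 4 / ((n : ℝ) + 4) ∧
        Module.End.eigenspace (Matrix.toLin' (tensorCov d (uniformBall n (R n))))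
            (eigenvalueAt (tensorCov d (uniformBall n (R n))) 1)
          = Submodule.span ℝ {coeffVec d (∑ j : Fin n, MvPolynomial.X j ^ 2)} ∧
        ∀ i, 2 ≤ i → i ≤ (d + n - 1).choose d →
          5 / 7 ≤ eigenvalueAt (tensorCov d (uniformBall n (R n))) i) ∧
      (fun n : ℕ => eigenvalueAt (tensorCov d (uniformBall n (R n))) 1)
        =O[atTop] fun n : ℕ => ((n : ℝ))⁻¹) ∧
    -- the case `d ≥ 3`
    (3 ≤ d →
      (∀ n, 1 ≤ n → ∀ i, 1 ≤ i → i ≤ (d + n - 1).choose d →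
        1 / ((d + 1)! : ℝ) ≤ eigenvalueAt (tensorCov d (uniformBall n (R n))) i) ∧
      (∀ n, d ≤ n →
        Module.End.eigenspace (Matrix.toLin' (tensorCov d (uniformBall n (R n))))
            (eigenvalueAt (tensorCov d (uniformBall n (R n))) 1)
          = Submodule.span ℝ {v | ∃ S : Finset (Fin n), S.card = d ∧
              v = coeffVec d (∏ j ∈ S, MvPolynomial.X j)}) ∧
      Tendsto (fun n : ℕ => eigenvalueAt (tensorCov d (uniformBall n (R n))) 1) atTop (𝓝 1) ∧
      Tendsto (fun n : ℕ => eigenvalueAt (tensorCovTilde d (uniformBall n (R n))) 1)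
        atTop (𝓝 1)) := by

  have hpos : ∀ n, 1 ≤ n → 0 < R n := fun n hn => (hR n hn).1
  have hsq : ∀ n, 1 ≤ n → R n ^ 2 = n + 2 := fun n hn =>
    TensorCov.sq_eq_of_isIsotropicRadius hn (hR n hn)
  refine ⟨fun n hn => TensorCov.eigenvalueAt_comparison hn (hpos n hn), ?_, ?_⟩
  · rintro rfl
    refine ⟨fun n hn => ?_, TensorCov.isBigO_eigenvalueAt_tensorCov_two hpos hsq⟩
    have h0 := hpos n (by omega)
    have h2 := hsq n (by omega)
    exact ⟨TensorCov.eigenvalueAt_one_tensorCov_two hn h0 h2,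
      TensorCov.eigenspace_tensorCov_two hn h0 h2,
      fun i h1 hi => TensorCov.le_eigenvalueAt_tensorCov_two hn h0 h2 h1 hi⟩
  · intro hd
    have hlim := TensorCov.tendsto_ballMomentRatio d hsq
    refine ⟨fun n hn i h1 hi => ?_, fun n hn => ?_, ?_, ?_⟩
    · exact (TensorCov.one_div_factorial_le_ballMomentRatio d (hsq n hn)).trans
        (TensorCov.ballMomentRatio_le_eigenvalueAt hn hd (hpos n hn) h1 hi)
    · exact TensorCov.eigenspace_tensorCov hd hn (hpos n (by omega))
    · refine hlim.congr' ?_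
      filter_upwards [eventually_ge_atTop d] with n hn
      exact (TensorCov.eigenvalueAt_one_tensorCov hd hn (hpos n (by omega))).symm
    · refine hlim.congr' ?_
      filter_upwards [eventually_ge_atTop d] with n hn
      exact (TensorCov.eigenvalueAt_one_tensorCovTilde hd hn (hpos n (by omega))).symm
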